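/- Let $d$ be a natural number and let $f:(\mathbb C^d,0)\to(\mathbb C^d,0)$ be a holomorphic germ which is contracting (every eigenvalue of $df_0$ has modulus $<1$) and rigid, i.e. its generalized critical set $\mathcal C^\infty(f)=\bigcup_{n\ge 0}f^{-n}(\mathcal C(f))$, where $\mathcal C(f)=\{\det df=0\}$, is, near $0$, a (possibly empty) hypersurface with simple normal crossings. Let $W^1,\dots,W^q$ be the irreducible components of $\mathcal C^\infty(f)$ at $0$, and let $A=(a_l^k)\in\mathbb N^{q\times q}$ be the internal action of $f$, defined by $f^*W^k=\sum_{l=1}^q a_l^k\,W^l$ as divisors ($k=1,\dots,q$), with $a_l^k$ the entry in row $l$ and column $k$. The component $W^k$ is called periodic if $(f^*)^\eta W^k=W^k$ for some $\eta\ge 1$, and fixed if $f^*W^k=W^k$. Assume that $A$ is injective (on $\mathbb Z^q$), that every periodic component is fixed, and that the nilpotent part of $df_0$ vanishes, i.e. $df_0$ is zero on its generalized eigenspace for the eigenvalue $0$. Let $s$ be the number of non-zero eigenvalues of $df_0$, counted with multiplicity, and let $p$ be the number of non-periodic irreducible components of $\mathcal C^\infty(f)$. Then there are germs at $0$ of smooth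 (non-singular) holomorphic foliations $\mathcal F_1,\dots,\mathcal F_s$ and $\mathcal G$ of $(\mathbb C^d,0)$, all preserved by $f$ (near $0$, $f$ maps leaves into leaves), such that $\mathcal F_k$ has codimension $k$ for $k=1,\dots,s$ and $\mathcal G$ has codimension $s+p$; moreover $\mathcal F_l$ is a subfoliation of $\mathcal F_k$ whenever $1\le k\le l\le s$ (every leaf of $\mathcal F_l$ is, near $0$, contained in a leaf of $\mathcal F_k$), and, if $s\ge 1$, $\mathcal G$ is a subfoliation of $\mathcal F_s$. -/

import Mathlib

open Filter Topology

/-! Germs at the origin of `ℂ^d` are represented by globally defined functions; only the values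
near `0` matter in every definition below. -/

/-- `f` represents a holomorphic germ `(ℂ^d, 0) → (ℂ^d, 0)`. -/
structure IsHolomorphicGerm {d : ℕ} (f : (Fin d → ℂ) → (Fin d → ℂ)) : Prop where
  analyticAt : AnalyticAt ℂ f 0
  map_zero : f 0 = 0

/-- The differential `df₀`, as an endomorphism of `ℂ^d`. -/
noncomputable def differentialAtZero {d : ℕ} (f : (Fin d → ℂ) → (Fin d → ℂ)) :
    Module.End ℂ (Fin d → ℂ) :=
  (fderiv ℂ f 0 : (Fin d → ℂ) →ₗ[ℂ] (Fin d → ℂ))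

/-- A germ is contracting if all the eigenvalues of `df₀` have modulus `< 1`. -/
def IsContractingGerm {d : ℕ} (f : (Fin d → ℂ) → (Fin d → ℂ)) : Prop :=
  ∀ μ : ℂ, (differentialAtZero f).HasEigenvalue μ → ‖μ‖ < 1

/-- The number of non-zero eigenvalues of `df₀`, counted with algebraic multiplicity. -/
noncomputable def numNonzeroEigenvalues {d : ℕ} (f : (Fin d → ℂ) → (Fin d → ℂ)) : ℕ :=
  ((differentialAtZero f).charpoly.roots.filter (fun μ : ℂ => μ ≠ 0)).card

/-- The nilpotent part of `df₀`, that is, its restriction to the generalized eigenspace of the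
eigenvalue `0`, vanishes. -/
def NilpotentPartVanishes {d : ℕ} (f : (Fin d → ℂ) → (Fin d → ℂ)) : Prop :=
  ∀ v ∈ (differentialAtZero f).maxGenEigenspace 0, differentialAtZero f v = 0

/-- The critical set of `f`. -/
def criticalSet {d : ℕ} (f : (Fin d → ℂ) → (Fin d → ℂ)) : Set (Fin d → ℂ) :=
  {x | (fderiv ℂ f x).det = 0}

/-- The generalized critical set `⋃ₙ f⁻ⁿ(C(f))`. For a contracting germ `0` has arbitrarily small
forward invariant neighbourhoods, so the germ of this set at `0` depends only on the germ of `f`. -/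
def genCriticalSet {d : ℕ} (f : (Fin d → ℂ) → (Fin d → ℂ)) : Set (Fin d → ℂ) :=
  ⋃ n : ℕ, (f^[n]) ⁻¹' criticalSet f

/-- Near `0`, the set `Z` is a simple normal crossings hypersurface, with irreducible components
the smooth hypersurfaces `{w l = 0}`, `l : Fin q`, which pass through `0` and meet there
transversely (`q = 0` means that `Z` is empty near `0`). -/
structure IsSNCAtZero {d q : ℕ} (Z : Set (Fin d → ℂ)) (w : Fin q → (Fin d → ℂ) → ℂ) : Prop where
  analyticAt : ∀ l, AnalyticAt ℂ (w l) 0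
  map_zero : ∀ l, w l 0 = 0
  transverse : LinearIndependent ℂ (fun l => fderiv ℂ (w l) 0)
  mem_iff : ∀ᶠ x in 𝓝 (0 : Fin d → ℂ), x ∈ Z ↔ ∃ l, w l x = 0

/-- The order of vanishing at `0` of the germ `h` along the smooth hypersurface `{u = 0}`: the
largest `n` such that `u ^ n` divides `h` in the ring of holomorphic germs (for `h ≢ 0`). -/
noncomputable def vanishingOrder {d : ℕ} (u h : (Fin d → ℂ) → ℂ) : ℕ :=
  sSup {n : ℕ | ∃ g : (Fin d → ℂ) → ℂ, AnalyticAt ℂ g 0 ∧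
    ∀ᶠ x in 𝓝 (0 : Fin d → ℂ), h x = u x ^ n * g x}

/-- The internal action of `f`, for the components `W^l = {w l = 0}` of the generalized critical
set: the matrix `A` with `f^* W^k = ∑ l, A l k • W^l` as divisors. -/
noncomputable def internalAction {d q : ℕ} (f : (Fin d → ℂ) → (Fin d → ℂ))
    (w : Fin q → (Fin d → ℂ) → ℂ) : Matrix (Fin q) (Fin q) ℕ :=
  Matrix.of fun l k => vanishingOrder (w l) (w k ∘ f)

/-- The matrix is injective, as an endomorphism of `ℤ^q`. -/
def IsInjectiveAction {q : ℕ} (A : Matrix (Fin q) (Fin q) ℕ) : Prop :=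
  Function.Injective (fun v : Fin q → ℤ => (A.map (fun n : ℕ => (n : ℤ))).mulVec v)

/-- The `k`-th component is fixed: `f^* W^k = W^k`. -/
def IsFixedComponent {q : ℕ} (A : Matrix (Fin q) (Fin q) ℕ) (k : Fin q) : Prop :=
  A.mulVec (Pi.single k 1) = Pi.single k 1

/-- The `k`-th component is periodic: `(f^*)^η W^k = W^k` for some `η ≥ 1`. -/
def IsPeriodicComponent {q : ℕ} (A : Matrix (Fin q) (Fin q) ℕ) (k : Fin q) : Prop :=
  ∃ η : ℕ, 1 ≤ η ∧ (A ^ η).mulVec (Pi.single k 1) = Pi.single k 1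

/-- The number of non-periodic components. -/
noncomputable def numNonperiodic {q : ℕ} (A : Matrix (Fin q) (Fin q) ℕ) : ℕ :=
  Nat.card {k : Fin q // ¬ IsPeriodicComponent A k}

/-- A germ at `0 ∈ ℂ^d` of a smooth (that is, non-singular) holomorphic foliation of codimension
`k`, given by a holomorphic submersion germ to `ℂ^k`. The leaves near `0` are its level sets. -/
structure SmoothFoliationGerm (d k : ℕ) where
  proj : (Fin d → ℂ) → (Fin k → ℂ)
  analyticAt : AnalyticAt ℂ proj 0
  submersion : Function.Surjective (fderiv ℂ proj 0)

/-- `x` and `y` (close to `0`) lie on the same local leaf. -/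
def SmoothFoliationGerm.SameLeaf {d k : ℕ} (F : SmoothFoliationGerm d k)
    (x y : Fin d → ℂ) : Prop :=
  F.proj x = F.proj y

/-- `F` is a subfoliation of `G`: near `0`, every leaf of `F` is contained in a leaf of `G`. -/
def SmoothFoliationGerm.IsSubfoliation {d k l : ℕ} (F : SmoothFoliationGerm d l)
    (G : SmoothFoliationGerm d k) : Prop :=
  ∃ U ∈ 𝓝 (0 : Fin d → ℂ), ∀ x ∈ U, ∀ y ∈ U, F.SameLeaf x y → G.SameLeaf x y

/-- `f` preserves `F`: near `0`, it maps every leaf of `F` into a leaf of `F`. -/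
def SmoothFoliationGerm.IsPreservedBy {d k : ℕ} (F : SmoothFoliationGerm d k)
    (f : (Fin d → ℂ) → (Fin d → ℂ)) : Prop :=
  ∃ U ∈ 𝓝 (0 : Fin d → ℂ), ∀ x ∈ U, ∀ y ∈ U, F.SameLeaf x y → F.SameLeaf (f x) (f y)

/-! ### Sums of uniformly summable series of analytic functions of several variables -/

section Weierstrass

open Metric

variable {E G : Type*} [NormedAddCommGroup E] [NormedSpace ℂ E] [NormedAddCommGroup G]
  [NormedSpace ℂ G]

/-! The leaves of the first `s` foliations are fibres of functions `φ i` in which `f` is triangular.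
Take a basis making `df₀` lower triangular with eigenvalues of decreasing modulus, so that the
non-zero ones come first. A Poincaré-Dulac argument deforms the first `s` coordinates into `φ i`,
with the same differentials, such that `φ i ∘ f - μ i * φ i` depends only on the earlier `φ j`:
non-resonant monomials are coboundaries, a resonance `μ k = ∏ μ (σ t)` with at least two factors
involves only indices below `k` because all moduli are less than one, and terms of high order are
removed by a geometric series (`IsAdaptedBasis.exists_triangular`). "Depends only on" means "is
constant on the common fibres", so the normal form is never written down.

Since the nilpotent part vanishes, `df₀` kills the directions tangent at `0` to the fibres of `(φ
i)`, `i < s`. Hence near `0` the map `f` contracts these fibres at every prescribed rate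
(`IsContractedFibration`). This beats any fixed exponential growth.

The generalized critical set contains its preimage under `f`, so normal crossings give `w k ∘ f = u
k * ∏ w l ^ a` with `u k` a unit and `a` the entry of the internal action. Multiplying `w k` by `exp
(g k)` changes the logarithm of the unit by `g ∘ f - Aᵀ g`. Along fibres the resulting equation is
solved by a series in powers of the inverse of `Aᵀ`, which exists by injectivity; the new unit is
then constant on fibres (`IsContractedFibration.exists_monomial_coordinates`). For a fixed component
the relation reads `v k ∘ f = m k * v k`, and fast contraction forces `v k` itself to be constant on
fibres (`IsContractedFibration.mem_leafwiseConstant`).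

The last foliation is cut out by the `φ i`, `i < s`, together with the `v k` of the non-periodic
components. The periodic `v k` are automatically constant on its leaves, so the monomial relations
show that it is preserved. Its codimension is right because the differential of a non-periodic
component is killed by a power of the transpose of `df₀`, whereas the span of the first `s` dual
basis forms contains no non-zero form of this kind (`IsSNCAtZero.fderiv_mem_eventuallyKilled`,
`IsAdaptedBasis.eq_zero_of_mem_eventuallyKilled`). -/

theorem norm_fderiv_le_of_forall_mem_ball {F : E → G} {x : E} {δ M : ℝ} (hδ : 0 < δ)
    (hF : AnalyticOnNhd ℂ F (ball x δ)) (hM : ∀ y ∈ ball x δ, ‖F y‖ ≤ M) :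
    ‖fderiv ℂ F x‖ ≤ 2 * M / δ := by
  refine Complex.norm_fderiv_le_div_of_mapsTo_ball hF.differentiableOn (fun y hy => ?_) hδ
  rw [mem_closedBall, dist_eq_norm]
  refine (norm_sub_le _ _).trans ?_
  linarith [hM y hy, hM x (mem_ball_self hδ)]

/-- Each derivative costs one Cauchy estimate on a ball of radius `η`, so the domain shrinks by `η`
at every step. -/
theorem norm_iteratedFDeriv_le_of_forall_mem_ball [CompleteSpace G] {F : E → G} {M η : ℝ}
    (hη : 0 < η) (n : ℕ) (x : E)
    (hF : AnalyticOnNhd ℂ F (ball x ((n + 1) * η))) (hM : ∀ y ∈ ball x ((n + 1) * η), ‖F y‖ ≤ M) :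
    ‖iteratedFDeriv ℂ n F x‖ ≤ M * (2 / η) ^ n := by
  induction n generalizing x with
  | zero => simpa using hM x (mem_ball_self (by positivity))
  | succ n ih =>
    rw [← norm_fderiv_iteratedFDeriv]
    have hsub : ∀ y ∈ ball x η, ball y ((n + 1) * η) ⊆ ball x (((n + 1 : ℕ) + 1) * η) := by
      intro y hy
      refine ball_subset_ball' ?_
      rw [mem_ball] at hy
      push_cast
      linarith
    refine (norm_fderiv_le_of_forall_mem_ball (M := M * (2 / η) ^ n) hη ?_ ?_).trans ?_
    · refine (hF.iteratedFDeriv n).mono (ball_subset_ball ?_)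
      push_cast
      nlinarith [n.cast_nonneg (α := ℝ)]
    · intro y hy
      exact ih y (hF.mono (hsub y hy)) fun z hz => hM z (hsub y hy hz)
    · rw [pow_succ]
      apply le_of_eq
      ring

theorem nat_pow_self_le_factorial_mul_exp (n : ℕ) :
    (n : ℝ) ^ n ≤ n.factorial * Real.exp n := by
  have h := Real.sum_le_exp_of_nonneg (x := n) n.cast_nonneg (n + 1)
  have h2 : (n : ℝ) ^ n / n.factorial ≤ Real.exp n :=
    (Finset.single_le_sum (f := fun i : ℕ => (n : ℝ) ^ i / (i.factorial : ℝ))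
      (fun i _ => by positivity) (Finset.self_mem_range_succ n)).trans h
  rwa [div_le_iff₀ (by positivity), mul_comm] at h2

/-- The Taylor series at `0`, as a formal multilinear series. -/
noncomputable def taylorFormal (F : E → G) : FormalMultilinearSeries ℂ E G :=
  fun n => ((n.factorial : ℂ)⁻¹) • iteratedFDeriv ℂ n F 0

theorem norm_taylorFormal_le [CompleteSpace G] {F : E → G} {M δ : ℝ} (hδ : 0 < δ)
    (hF : AnalyticOnNhd ℂ F (ball 0 δ)) (hM : ∀ y ∈ ball (0 : E) δ, ‖F y‖ ≤ M) (n : ℕ) :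
    ‖taylorFormal F n‖ ≤ M * (16 / δ) ^ n := by
  have hM0 : 0 ≤ M := (norm_nonneg _).trans (hM 0 (mem_ball_self hδ))
  rcases Nat.eq_zero_or_pos n with rfl | hn
  · simpa [taylorFormal] using hM 0 (mem_ball_self hδ)
  have hn' : (0 : ℝ) < n := by exact_mod_cast hn
  have hn1 : (1 : ℝ) ≤ n := by exact_mod_cast hn
  -- Sharing the radius among `n` derivatives produces a factor `n ^ n`, absorbed by `n!` up to `exp
  -- n ≤ 4 ^ n`; hence the constant 16.
  have hη : 0 < δ / (2 * n) := by positivity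
  have hle : ((n : ℝ) + 1) * (δ / (2 * n)) ≤ δ := by
    rw [mul_div_assoc', div_le_iff₀ (by positivity)]
    nlinarith
  have h := norm_iteratedFDeriv_le_of_forall_mem_ball hη n (0 : E)
    (hF.mono (ball_subset_ball hle)) fun y hy => hM y (ball_subset_ball hle hy)
  have h1 : (2 / (δ / (2 * (n : ℝ)))) ^ n = (4 / δ) ^ n * (n : ℝ) ^ n := by
    rw [← mul_pow]; congr 1; field_simp; norm_num
  have h2 : (Real.exp n) ≤ 4 ^ n := by
    rw [← mul_one (n : ℝ), Real.exp_nat_mul]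
    exact pow_le_pow_left₀ (Real.exp_pos _).le (by linarith [Real.exp_one_lt_d9]) n
  have h3 := nat_pow_self_le_factorial_mul_exp n
  unfold taylorFormal
  rw [norm_smul, norm_inv, Complex.norm_natCast, inv_mul_le_iff₀ (by positivity)]
  calc _ ≤ M * ((4 / δ) ^ n * (n : ℝ) ^ n) := by rw [← h1]; exact h
    _ ≤ M * ((4 / δ) ^ n * (n.factorial * 4 ^ n)) := by gcongr; exact h3.trans (by gcongr)
    _ = _ := by
      rw [show (16 / δ) = 4 / δ * 4 by ring, mul_pow]; ring

theorem le_radius_of_norm_le_mul_pow {p : FormalMultilinearSeries ℂ E G} {C δ : ℝ} (hδ : 0 < δ)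
    (h : ∀ n, ‖p n‖ ≤ C * (16 / δ) ^ n) : ENNReal.ofReal (δ / 16) ≤ p.radius := by
  refine p.le_radius_of_bound C fun n => ?_
  rw [Real.coe_toNNReal _ (by positivity)]
  calc _ ≤ C * (16 / δ) ^ n * (δ / 16) ^ n := by gcongr; exact h n
    _ = C := by
      rw [mul_assoc, ← mul_pow]
      have : 16 / δ * (δ / 16) = 1 := by field_simp
      rw [this, one_pow, mul_one]

/-- Near `0` the symmetrized Taylor series agrees with any power series of `F` on the diagonal; the
identity theorem extends this to the ball where the norm bounds guarantee convergence. -/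
theorem hasSum_taylorFormal [CompleteSpace G] {F : E → G} {M δ : ℝ} (hδ : 0 < δ)
    (hF : AnalyticOnNhd ℂ F (ball 0 δ)) (hM : ∀ y ∈ ball (0 : E) δ, ‖F y‖ ≤ M) {x : E}
    (hx : x ∈ ball (0 : E) (δ / 16)) :
    HasSum (fun n => taylorFormal F n fun _ => x) (F x) := by
  have hr := le_radius_of_norm_le_mul_pow hδ (norm_taylorFormal_le hδ hF hM)
  have hpos : 0 < (taylorFormal F).radius :=
    lt_of_lt_of_le (by rw [ENNReal.ofReal_pos]; positivity) hr
  have hball : ∀ y ∈ ball (0 : E) (δ / 16), y ∈ eball (0 : E) (taylorFormal F).radius := by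
    intro y hy
    refine eball_subset_eball hr ?_
    rwa [eball_ofReal]
  have hsum := (taylorFormal F).hasFPowerSeriesOnBall hpos
  obtain ⟨p, r, hp⟩ := hF 0 (mem_ball_self hδ)
  have hdiag : ∀ n (y : E), (taylorFormal F n fun _ => y) = p n fun _ => y := by
    intro n y
    simp only [taylorFormal, smul_apply]
    rw [hp.iteratedFDeriv_eq_sum_of_completeSpace]
    simp only [Finset.sum_const, Finset.card_univ, Fintype.card_perm, Fintype.card_fin]
    rw [← Nat.cast_smul_eq_nsmul ℂ, smul_smul, inv_mul_cancel₀ (Nat.cast_ne_zero.mpr n.factorial_ne_zero), one_smul]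
  have hev : F =ᶠ[𝓝 0] (taylorFormal F).sum := by
    filter_upwards [eball_mem_nhds (0 : E) hp.r_pos] with y hy
    have := (hp.hasSum hy).tsum_eq
    rw [zero_add] at this
    rw [← this, FormalMultilinearSeries.sum]
    simp only [hdiag]
  have heq : Set.EqOn F (taylorFormal F).sum (ball 0 (δ / 16)) := by
    refine AnalyticOnNhd.eqOn_of_preconnected_of_eventuallyEq
      (hF.mono (ball_subset_ball (by linarith))) ?_
      ((convex_ball (0 : E) (δ / 16)).isPreconnected) (mem_ball_self (by positivity)) hev
    intro y hy
    exact hsum.analyticAt_of_mem (hball y hy)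
  have := hsum.hasSum (hball x hx)
  rw [zero_add] at this
  rwa [heq hx]

/-- A uniformly summable series of analytic functions has an analytic sum. -/
theorem analyticAt_tsum_of_norm_le [CompleteSpace G] {F : ℕ → E → G} {M : ℕ → ℝ} {δ : ℝ}
    (hδ : 0 < δ) (hF : ∀ k, AnalyticOnNhd ℂ (F k) (ball 0 δ))
    (hM : ∀ k, ∀ y ∈ ball (0 : E) δ, ‖F k y‖ ≤ M k) (hsum : Summable M) :
    AnalyticAt ℂ (fun x => ∑' k, F k x) 0 := by
  have hb : ∀ n k, ‖taylorFormal (F k) n‖ ≤ M k * (16 / δ) ^ n := fun n k =>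
    norm_taylorFormal_le hδ (hF k) (hM k) n
  have hS : ∀ n, Summable fun k => taylorFormal (F k) n := fun n =>
    Summable.of_norm_bounded (hsum.mul_right _) (hb n)
  set q : FormalMultilinearSeries ℂ E G := fun n => ∑' k, taylorFormal (F k) n with hq
  have hqb : ∀ n, ‖q n‖ ≤ (∑' k, M k) * (16 / δ) ^ n := by
    intro n
    rw [← tsum_mul_right]
    exact tsum_of_norm_bounded ((hsum.mul_right _).hasSum) (hb n)
  have hqr := le_radius_of_norm_le_mul_pow hδ hqb
  -- Half the guaranteed radius gives the bound `M k * (1 / 2) ^ n`, summable in both indices, so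
  -- the two summations may be exchanged.
  refine ⟨q, ENNReal.ofReal (δ / 32), ?_, ?_, ?_⟩
  · refine le_trans (ENNReal.ofReal_le_ofReal (by linarith)) hqr
  · rw [ENNReal.ofReal_pos]; positivity
  intro y hy
  rw [eball_ofReal, mem_ball_zero_iff] at hy
  rw [zero_add]
  have hy16 : y ∈ ball (0 : E) (δ / 16) := by rw [mem_ball_zero_iff]; linarith
  have hterm : ∀ k n, ‖taylorFormal (F k) n fun _ => y‖ ≤ M k * (1 / 2) ^ n := by
    intro k n
    have hMk : 0 ≤ M k := (norm_nonneg _).trans (hM k 0 (mem_ball_self hδ))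
    calc _ ≤ ‖taylorFormal (F k) n‖ * ‖y‖ ^ n := by
          simpa using (taylorFormal (F k) n).le_opNorm fun _ => y
      _ ≤ (M k * (16 / δ) ^ n) * (δ / 32) ^ n := by gcongr; exact hb n k
      _ = M k * (1 / 2) ^ n := by
        rw [mul_assoc, ← mul_pow]; congr 2; field_simp; norm_num
  have hdouble : Summable fun z : ℕ × ℕ => taylorFormal (F z.1) z.2 fun _ => y := by
    refine Summable.of_norm_bounded (g := fun z : ℕ × ℕ => M z.1 * (1 / 2 : ℝ) ^ z.2) ?_
      fun z => hterm z.1 z.2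
    exact hsum.mul_of_nonneg (summable_geometric_of_lt_one (by norm_num) (by norm_num))
      (fun k => (norm_nonneg _).trans (hM k 0 (mem_ball_self hδ))) fun n => by positivity
  have happ : ∀ n, HasSum (fun k => taylorFormal (F k) n fun _ => y) (q n fun _ => y) := by
    intro n
    exact ((hS n).hasSum).map
      (ContinuousMultilinearMap.apply ℂ (fun _ : Fin n => E) G fun _ => y)
      (ContinuousMultilinearMap.apply ℂ (fun _ : Fin n => E) G fun _ => y).continuous
  have h1 := hdouble.hasSum
  have h2 := h1.prod_fiberwise fun k => hasSum_taylorFormal hδ (hF k) (hM k) hy16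
  have h3 := (h1.tsum_eq ▸ (Equiv.prodComm ℕ ℕ).hasSum_iff.mpr h1).prod_fiberwise happ
  rw [h2.tsum_eq]
  exact h3

end Weierstrass

/-! ### Division by a linear form -/

section Division

open Metric

variable {E : Type*} [NormedAddCommGroup E] [NormedSpace ℂ E]

/-- Telescoping: `x` is replaced by `y` in one slot at a time. -/
theorem ContinuousMultilinearMap.apply_const_sub_apply_const {n : ℕ}
    (p : ContinuousMultilinearMap ℂ (fun _ : Fin n => E) ℂ) (x y : E) :
    (p fun _ => x) - (p fun _ => y) =
      ∑ i : Fin n, p (Function.update (fun j => if j < i then y else x) i (x - y)) := by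
  have h := Finset.sum_range_sub' (fun i : ℕ => p fun j : Fin n => if (j : ℕ) < i then y else x) n
  simp only [Nat.not_lt_zero, if_false, Fin.is_lt, if_true] at h
  rw [← h, Finset.sum_range]
  refine Finset.sum_congr rfl fun i _ => ?_
  rw [p.map_update_sub]
  congr 2
  · funext j
    rcases eq_or_ne j i with rfl | hj
    · simp
    · simp [Function.update_of_ne hj]
  · funext j
    rcases eq_or_ne j i with rfl | hj
    · simp
    · rw [Function.update_of_ne hj]
      have : (j : ℕ) < i + 1 ↔ j < i := by
        rw [Fin.lt_def, Nat.lt_succ_iff_lt_or_eq]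
        simp [Fin.val_inj, hj]
      simp [this]

/-- A holomorphic germ which vanishes on the kernel of a linear form is divisible by it. -/
theorem AnalyticAt.exists_eq_mul_of_eq_zero {g : E → ℂ} (hg : AnalyticAt ℂ g 0)
    {ω : E →L[ℂ] ℂ} {v : E} (hv : ω v = 1) (hz : ∀ᶠ x in 𝓝 (0 : E), ω x = 0 → g x = 0) :
    ∃ g' : E → ℂ, AnalyticAt ℂ g' 0 ∧ ∀ᶠ x in 𝓝 (0 : E), g x = ω x * g' x := by
  obtain ⟨p, r, hp⟩ := hg
  obtain ⟨C, a, hC, ha, hpa⟩ := p.le_mul_pow_of_radius_pos (hp.r_pos.trans_le hp.r_le)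
  set K : ℝ := 1 + ‖ω‖ * ‖v‖ with hK
  have hK1 : 1 ≤ K := by rw [hK]; linarith [mul_nonneg (norm_nonneg ω) (norm_nonneg v)]
  set P : E → E := fun x => x - ω x • v with hP
  have hPK : ∀ x, ‖P x‖ ≤ K * ‖x‖ := by
    intro x
    calc ‖P x‖ ≤ ‖x‖ + ‖ω x • v‖ := norm_sub_le _ _
      _ ≤ ‖x‖ + ‖ω‖ * ‖x‖ * ‖v‖ := by
        rw [norm_smul]; gcongr; exact ω.le_opNorm x
      _ = K * ‖x‖ := by rw [hK]; ring
  have hPa : ∀ x, AnalyticAt ℂ P x := fun x => by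
    have := ω.analyticAt x
    fun_prop
  -- `P` projects onto the kernel of `ω` along `v`, so `g (P x) = 0` and `g x` is the sum of the
  -- differences `p n (x, …) - p n (P x, …)`. After telescoping, each summand has the slot `x - P x
  -- = ω x • v`, from which `ω x` is extracted.
  have hP0 : Tendsto P (𝓝 0) (𝓝 0) := by
    have := (hPa 0).continuousAt.tendsto
    simpa [hP] using this
  have hωP : ∀ x, ω (P x) = 0 := fun x => by simp [hP, hv]
  -- All slots are kept of norm at most `b`, with `v` rescaled by `c` for this purpose; the `n`
  -- telescoping terms then cost `n * (1 / 4) ^ n ≤ (1 / 2) ^ n`.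
  obtain ⟨b, hb0, hb⟩ : ∃ b : ℝ, 0 < b ∧ a * b = 1 / 4 := ⟨1 / (4 * a), by positivity, by field_simp⟩
  obtain ⟨c, hc0, hc⟩ : ∃ c : ℂ, c ≠ 0 ∧ ‖c • v‖ ≤ b := by
    refine ⟨((b / (‖v‖ + 1) : ℝ) : ℂ), ?_, ?_⟩
    · have : b / (‖v‖ + 1) ≠ 0 := by positivity
      exact_mod_cast this
    · rw [norm_smul, Complex.norm_real, Real.norm_of_nonneg (by positivity), div_mul_eq_mul_div,
        div_le_iff₀ (by positivity)]
      nlinarith [norm_nonneg v]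
  set term : ℕ → E → ℂ := fun n x =>
    ∑ i : Fin n, p n (Function.update (fun j => if j < i then P x else x) i (c • v)) with hterm
  set δ : ℝ := b / K with hδ
  have hδ0 : 0 < δ := by positivity
  have hsmall : ∀ x ∈ ball (0 : E) δ, ‖x‖ ≤ b ∧ ‖P x‖ ≤ b := by
    intro x hx
    rw [mem_ball_zero_iff, hδ, lt_div_iff₀ (by positivity)] at hx
    refine ⟨?_, (hPK x).trans (by linarith)⟩
    nlinarith [norm_nonneg x]
  have htb : ∀ n, ∀ x ∈ ball (0 : E) δ, ‖term n x‖ ≤ C * (1 / 2) ^ n := by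
    intro n x hx
    have h1 : ∀ i : Fin n, ‖p n (Function.update (fun j => if j < i then P x else x) i (c • v))‖
        ≤ C * (1 / 4) ^ n := by
      intro i
      have hm : ‖Function.update (fun j => if j < i then P x else x) i (c • v)‖ ≤ b := by
        rw [pi_norm_le_iff_of_nonneg hb0.le]
        intro j
        rcases eq_or_ne j i with rfl | hj
        · simpa using hc
        · rw [Function.update_of_ne hj]
          split_ifs
          · exact (hsmall x hx).2
          · exact (hsmall x hx).1
      calc _ ≤ ‖p n‖ * b ^ n := by
            have := (p n).le_opNorm_mul_pow_of_le hm
            simpa using this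
        _ ≤ C * a ^ n * b ^ n := by gcongr; exact hpa n
        _ = C * (1 / 4) ^ n := by rw [mul_assoc, ← mul_pow, hb]
    calc ‖term n x‖ ≤ ∑ _i : Fin n, C * (1 / 4 : ℝ) ^ n := norm_sum_le_of_le _ fun i _ => h1 i
      _ = n * (C * (1 / 4) ^ n) := by simp
      _ ≤ 2 ^ n * (C * (1 / 4) ^ n) := by
        gcongr
        exact_mod_cast n.lt_two_pow_self.le
      _ = C * (1 / 2) ^ n := by
        rw [show (1 / 2 : ℝ) = 2 * (1 / 4) by norm_num, mul_pow]; ring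
  have hta : ∀ n x, AnalyticAt ℂ (term n) x := by
    intro n x
    refine Finset.analyticAt_fun_sum _ fun i _ => ?_
    refine AnalyticAt.comp (f := fun x => Function.update (fun j => if j < i then P x else x) i (c • v))
      (p n).analyticAt (AnalyticAt.pi fun j => ?_)
    rcases eq_or_ne j i with rfl | hj
    · simp only [Function.update_self]
      exact analyticAt_const
    · simp only [Function.update_of_ne hj]
      split_ifs
      · exact hPa x
      · exact analyticAt_id
  have hA := analyticAt_tsum_of_norm_le hδ0 (fun k x _ => hta k x) htb
    ((summable_geometric_of_lt_one (by norm_num) (by norm_num)).mul_left C)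
  refine ⟨fun x => c⁻¹ * ∑' n, term n x, analyticAt_const.mul hA, ?_⟩
  filter_upwards [hP0.eventually hz, eball_mem_nhds (0 : E) hp.r_pos,
    hP0.eventually (eball_mem_nhds (0 : E) hp.r_pos)] with x hx1 hx2 hx3
  have h1 := (hp.hasSum hx2).sub (hp.hasSum hx3)
  rw [zero_add, zero_add, hx1 (hωP x), sub_zero] at h1
  have h2 : ∀ n, ((p n fun _ => x) - p n fun _ => P x) = ω x * c⁻¹ * term n x := by
    intro n
    rw [(p n).apply_const_sub_apply_const, hterm, Finset.mul_sum]
    refine Finset.sum_congr rfl fun i _ => ?_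
    have : x - P x = (ω x * c⁻¹) • (c • v) := by
      rw [smul_smul, mul_assoc, inv_mul_cancel₀ hc0, mul_one, hP]
      simp
    rw [this, (p n).map_update_smul, smul_eq_mul]
  simp only [h2] at h1
  rw [← h1.tsum_eq, tsum_mul_left, mul_assoc]

/-- The ring of germs is a domain: where one factor is non-zero the other vanishes on an open set,
and the identity theorem on a ball concludes. -/
theorem AnalyticAt.eventually_eq_zero_or_eventually_eq_zero {F G : E → ℂ} (hF : AnalyticAt ℂ F 0)
    (hG : AnalyticAt ℂ G 0) (h : ∀ᶠ x in 𝓝 (0 : E), F x * G x = 0) :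
    (∀ᶠ x in 𝓝 (0 : E), F x = 0) ∨ ∀ᶠ x in 𝓝 (0 : E), G x = 0 := by
  by_cases hF0 : ∀ᶠ x in 𝓝 (0 : E), F x = 0
  · exact Or.inl hF0
  refine Or.inr ?_
  obtain ⟨δ, hδ, hb⟩ := Metric.eventually_nhds_iff_ball.mp
    (h.and (hF.eventually_analyticAt.and hG.eventually_analyticAt))
  obtain ⟨x, hFx, hx⟩ := (Filter.not_eventually.mp hF0).and_eventually (ball_mem_nhds 0 hδ) |>.exists
  have hGx : G =ᶠ[𝓝 x] 0 := by
    filter_upwards [(hb x hx).2.1.continuousAt.eventually_ne hFx, isOpen_ball.mem_nhds hx]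
      with y hy hy'
    exact (mul_eq_zero.mp (hb y hy').1).resolve_left hy
  have := AnalyticOnNhd.eqOn_zero_of_preconnected_of_eventuallyEq_zero
    (fun y hy => (hb y hy).2.2) (convex_ball (0 : E) δ).isPreconnected hx hGx
  filter_upwards [ball_mem_nhds (0 : E) hδ] with y hy using this hy

theorem AnalyticAt.exists_eventually_eq_zero_of_prod {ι : Type*} (s : Finset ι) {F : ι → E → ℂ}
    (hF : ∀ i ∈ s, AnalyticAt ℂ (F i) 0) (h : ∀ᶠ x in 𝓝 (0 : E), ∏ i ∈ s, F i x = 0) :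
    ∃ i ∈ s, ∀ᶠ x in 𝓝 (0 : E), F i x = 0 := by
  classical
  induction s using Finset.induction_on with
  | empty =>
    simp only [Finset.prod_empty, one_ne_zero] at h
    exact absurd h.exists (by simp)
  | insert i s hi ih =>
    simp only [Finset.prod_insert hi] at h
    rcases (hF i (Finset.mem_insert_self i s)).eventually_eq_zero_or_eventually_eq_zero
      (Finset.analyticAt_fun_prod s fun j hj => hF j (Finset.mem_insert_of_mem hj)) h with h | h
    · exact ⟨i, Finset.mem_insert_self i s, h⟩
    · obtain ⟨j, hj, hj'⟩ := ih (fun j hj => hF j (Finset.mem_insert_of_mem hj)) h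
      exact ⟨j, Finset.mem_insert_of_mem hj, hj'⟩

/-- A germ vanishing at `0` but not identically along a line has zeros on all nearby parallel
lines. -/
theorem AnalyticAt.eventually_exists_zero_on_line {h : E → ℂ} (hh : AnalyticAt ℂ h 0)
    (h0 : h 0 = 0) {v : E} (hv : ∀ᶠ t in 𝓝[≠] (0 : ℂ), h (t • v) ≠ 0) {δ : ℝ} (hδ : 0 < δ) :
    ∀ᶠ p in 𝓝 (0 : E), ∃ t : ℂ, ‖t • v‖ < δ ∧ h (p + t • v) = 0 := by
  obtain ⟨R, hR, hRa⟩ := Metric.eventually_nhds_iff_ball.mp hh.eventually_analyticAt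
  have hsm : Tendsto (fun t : ℂ => t • v) (𝓝 0) (𝓝 0) := by
    have : ContinuousAt (fun t : ℂ => t • v) 0 := by fun_prop
    simpa using this.tendsto
  rw [eventually_nhdsWithin_iff] at hv
  obtain ⟨ε', hε', hb⟩ := Metric.eventually_nhds_iff_ball.mp
    (hv.and (hsm.eventually (ball_mem_nhds (0 : E) (lt_min hδ (half_pos hR)))))
  set ε := ε' / 2
  have hε : 0 < ε := half_pos hε'
  have hεb : ∀ t ∈ closedBall (0 : ℂ) ε, t ∈ ball (0 : ℂ) ε' := fun t ht => by
    rw [mem_closedBall_zero_iff] at ht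
    rw [mem_ball_zero_iff]
    exact ht.trans_lt (half_lt_self hε')
  have hcont : ∀ t ∈ closedBall (0 : ℂ) ε, ∀ p ∈ ball (0 : E) (R / 2), AnalyticAt ℂ h (p + t • v) := by
    intro t ht p hp
    apply hRa
    have h1 := (hb t (hεb t ht)).2
    rw [dist_zero_right] at h1
    rw [mem_ball_zero_iff] at *
    have := lt_of_lt_of_le h1 (min_le_right _ _)
    linarith [norm_add_le p (t • v)]
  obtain ⟨m, hm, hmin⟩ : ∃ m : ℝ, 0 < m ∧ ∀ t ∈ sphere (0 : ℂ) ε, m ≤ ‖h (t • v)‖ := by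
    obtain ⟨t₀, ht₀, hmin⟩ := (isCompact_sphere (0 : ℂ) ε).exists_isMinOn
      (NormedSpace.sphere_nonempty.mpr hε.le) (f := fun t : ℂ => ‖h (t • v)‖) (by
        intro t ht
        have := hcont t (sphere_subset_closedBall ht) 0 (by simpa using hR)
        rw [zero_add] at this
        refine ContinuousAt.continuousWithinAt ?_
        exact (ContinuousAt.comp (f := fun t : ℂ => t • v) this.continuousAt (by fun_prop)).norm)
    refine ⟨_, norm_pos_iff.mpr ((hb t₀ (hεb _ (sphere_subset_closedBall ht₀))).1 ?_), hmin⟩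
    exact ne_of_mem_sphere ht₀ hε.ne'
  have hev : ∀ᶠ p in 𝓝 (0 : E), ∀ t ∈ sphere (0 : ℂ) ε, m / 2 < ‖h (p + t • v)‖ := by
    refine (isCompact_sphere (0 : ℂ) ε).eventually_forall_of_forall_eventually fun t ht => ?_
    have hc := (hcont t (sphere_subset_closedBall ht) 0 (by simpa using hR)).continuousAt
    have : ContinuousAt (fun z : E × ℂ => ‖h (z.1 + z.2 • v)‖) (0, t) :=
      (ContinuousAt.comp (f := fun z : E × ℂ => z.1 + z.2 • v) (x := (0, t)) hc (by fun_prop)).norm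
    refine this.eventually (lt_mem_nhds ?_)
    simp only [zero_add]
    linarith [hmin t ht]
  have hev0 : ∀ᶠ p in 𝓝 (0 : E), ‖h p‖ < m / 2 := by
    have := hh.continuousAt.norm.tendsto
    rw [h0, norm_zero] at this
    exact this.eventually (gt_mem_nhds (half_pos hm))
  filter_upwards [hev, hev0, ball_mem_nhds (0 : E) (half_pos hR)] with p h1 h2 h3
  -- Without a zero in the disc, the maximum principle for `1 / h` bounds it at the centre by `2 /
  -- m`, contradicting `‖h p‖ < m / 2`.
  by_contra hcon
  push Not at hcon
  have hne : ∀ t ∈ closedBall (0 : ℂ) ε, h (p + t • v) ≠ 0 := by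
    intro t ht
    apply hcon
    have := (hb t (hεb t ht)).2
    rw [dist_zero_right] at this
    exact this.trans_le (min_le_left _ _)
  have hd : ∀ t ∈ closedBall (0 : ℂ) ε,
      DifferentiableAt ℂ (fun t : ℂ => (h (p + t • v))⁻¹) t := by
    intro t ht
    have := (hcont t ht p h3).differentiableAt
    exact (DifferentiableAt.comp (f := fun t : ℂ => p + t • v) t this (by fun_prop)).fun_inv
      (hne t ht)
  have hmax := Complex.norm_le_of_forall_mem_frontier_norm_le (U := ball (0 : ℂ) ε)
    (f := fun t : ℂ => (h (p + t • v))⁻¹) (C := (m / 2)⁻¹) isBounded_ball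
    ⟨fun t ht => (hd t (ball_subset_closedBall ht)).differentiableWithinAt, fun t ht =>
      (hd t (closure_ball_subset_closedBall ht)).continuousAt.continuousWithinAt⟩
    (fun t ht => by
      rw [frontier_ball _ hε.ne'] at ht
      rw [norm_inv]
      exact inv_anti₀ (by positivity) (h1 t ht).le) (z := 0) (subset_closure (mem_ball_self hε))
  simp only [zero_smul, add_zero, norm_inv] at hmax
  have h4 := hne 0 (mem_closedBall_self hε.le)
  rw [zero_smul, add_zero] at h4
  have := (inv_le_inv₀ (norm_pos_iff.mpr h4) (by positivity)).mp hmax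
  linarith

end Division

/-! ### Factorization along a simple normal crossings divisor -/

section Factorization

open Metric

variable {E : Type*} [NormedAddCommGroup E] [NormedSpace ℂ E]

theorem tendsto_smul_nhds_zero (v : E) : Tendsto (fun t : ℂ => t • v) (𝓝 0) (𝓝 0) := by
  have : ContinuousAt (fun t : ℂ => t • v) 0 := by fun_prop
  simpa using this.tendsto

/-- This stands in for the Nullstellensatz. Each line parallel to `v` near `0` carries a zero of
`h`, which must be its intersection with one of the hyperplanes. So the product of the `h ∘ pr l`,
with `pr l` the projection along `v`, vanishes identically, and hence so does one factor. -/
theorem AnalyticAt.exists_forall_eq_zero_on_ker {q : ℕ} {ω : Fin q → E →L[ℂ] ℂ} {v : E}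
    (hωv : ∀ l, ω l v ≠ 0) {h : E → ℂ} (hh : AnalyticAt ℂ h 0) (h0 : h 0 = 0)
    (hv : ∀ᶠ t in 𝓝[≠] (0 : ℂ), h (t • v) ≠ 0)
    (hz : ∀ᶠ x in 𝓝 (0 : E), h x = 0 → ∃ l, ω l x = 0) :
    ∃ l, ∀ᶠ x in 𝓝 (0 : E), ω l x = 0 → h x = 0 := by
  obtain ⟨R, hR, hRz⟩ := Metric.eventually_nhds_iff_ball.mp hz
  set pr : Fin q → E → E := fun l p => p - (ω l p / ω l v) • v with hpr
  have hpra : ∀ l, AnalyticAt ℂ (pr l) 0 := fun l => by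
    have := (ω l).analyticAt 0
    have h2 := hωv l
    fun_prop (disch := assumption)
  have hprod : ∀ᶠ p in 𝓝 (0 : E), ∏ l, h (pr l p) = 0 := by
    filter_upwards [hh.eventually_exists_zero_on_line h0 hv (half_pos hR),
      ball_mem_nhds (0 : E) (half_pos hR)] with p ⟨t, ht, hpt⟩ hp
    have hmem : p + t • v ∈ ball (0 : E) R := by
      rw [mem_ball_zero_iff] at *
      linarith [norm_add_le p (t • v)]
    obtain ⟨l, hl⟩ := hRz _ hmem hpt
    refine Finset.prod_eq_zero (Finset.mem_univ l) ?_
    have : t = -(ω l p / ω l v) := by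
      have h2 := hωv l
      rw [map_add, map_smul, smul_eq_mul] at hl
      field_simp
      linear_combination hl
    rw [hpr]
    simp only
    rw [← hpt, this, neg_smul, sub_eq_add_neg]
  obtain ⟨l, -, hl⟩ := AnalyticAt.exists_eventually_eq_zero_of_prod Finset.univ
    (F := fun l p => h (pr l p)) (fun l _ => by
      refine AnalyticAt.comp (f := pr l) ?_ (hpra l)
      simpa [hpr] using hh) hprod
  refine ⟨l, hl.mono fun x hx hx0 => ?_⟩
  simpa [hpr, hx0] using hx

/-- Induction on the order `M` of `h` along a line transverse to all the hyperplanes: dividing by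
one `ω l` lowers it by exactly one, and order zero means a unit. -/
theorem AnalyticAt.exists_factorization_linear {q : ℕ} {ω : Fin q → E →L[ℂ] ℂ} {v : E}
    (hωv : ∀ l, ω l v ≠ 0) {M : ℕ} {k : ℂ → ℂ} (hk : ContinuousAt k 0) (hk0 : k 0 ≠ 0)
    {h : E → ℂ} (hh : AnalyticAt ℂ h 0)
    (hv : ∀ᶠ t in 𝓝[≠] (0 : ℂ), h (t • v) = t ^ M * k t)
    (hz : ∀ᶠ x in 𝓝 (0 : E), h x = 0 → ∃ l, ω l x = 0) :
    ∃ (m : Fin q → ℕ) (u : E → ℂ), AnalyticAt ℂ u 0 ∧ u 0 ≠ 0 ∧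
      ∀ᶠ x in 𝓝 (0 : E), h x = u x * ∏ l, ω l x ^ m l := by
  induction M generalizing k h with
  | zero =>
    refine ⟨0, h, hh, ?_, by simp⟩
    have h1 : Tendsto (fun t : ℂ => h (t • v)) (𝓝[≠] 0) (𝓝 (h 0)) :=
      (hh.continuousAt.tendsto.comp (tendsto_smul_nhds_zero v)).mono_left nhdsWithin_le_nhds
    have h2 : Tendsto (fun t : ℂ => h (t • v)) (𝓝[≠] 0) (𝓝 (k 0)) :=
      (hk.tendsto.mono_left nhdsWithin_le_nhds).congr' (hv.mono fun t ht => by simpa using ht.symm)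
    rwa [tendsto_nhds_unique h1 h2]
  | succ M ih =>
    by_cases h0 : h 0 = 0
    swap
    · exact ⟨0, h, hh, h0, by simp⟩
    have hv' : ∀ᶠ t in 𝓝[≠] (0 : ℂ), h (t • v) ≠ 0 := by
      filter_upwards [hv, self_mem_nhdsWithin,
        (hk.eventually_ne hk0).filter_mono nhdsWithin_le_nhds] with t h1 h2 h3
      rw [h1]
      exact mul_ne_zero (pow_ne_zero _ h2) h3
    obtain ⟨l, hl⟩ := hh.exists_forall_eq_zero_on_ker hωv h0 hv' hz
    obtain ⟨h', hh', hdiv⟩ := hh.exists_eq_mul_of_eq_zero (v := (ω l v)⁻¹ • v)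
      (by simp [inv_mul_cancel₀ (hωv l)]) hl
    obtain ⟨m, u, hu, hu0, hfac⟩ := ih (k := fun t => k t / ω l v) (h := h')
      (hk.div_const _) (div_ne_zero hk0 (hωv l)) hh' (by
        filter_upwards [hv, self_mem_nhdsWithin,
          ((tendsto_smul_nhds_zero v).eventually hdiv).filter_mono nhdsWithin_le_nhds]
          with t h1 h2 h3
        have h2' : t ≠ 0 := h2
        rw [h1, map_smul, smul_eq_mul, pow_succ] at h3
        have h4 := hωv l
        field_simp
        have : t * (h' (t • v) * ω l v) = t * (t ^ M * k t) := by linear_combination -h3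
        exact mul_left_cancel₀ h2' this) (by
        filter_upwards [hz, hdiv] with x hx hx' h0
        exact hx (by rw [hx', h0, mul_zero]))
    refine ⟨Function.update m l (m l + 1), u, hu, hu0, ?_⟩
    filter_upwards [hdiv, hfac] with x hx hx'
    rw [hx, hx', ← Finset.mul_prod_erase _ _ (Finset.mem_univ l),
      ← Finset.mul_prod_erase _ (fun i => ω i x ^ Function.update m l (m l + 1) i)
        (Finset.mem_univ l), Function.update_self, pow_succ]
    have : ∏ i ∈ Finset.univ.erase l, ω i x ^ Function.update m l (m l + 1) i
        = ∏ i ∈ Finset.univ.erase l, ω i x ^ m i :=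
      Finset.prod_congr rfl fun i hi => by
        rw [Function.update_of_ne (Finset.ne_of_mem_erase hi)]
    rw [this]
    ring

/-- A form outside the span of the others cannot vanish on the intersection of their kernels. -/
theorem LinearIndependent.exists_dual_vectors {q : ℕ} {ω : Fin q → E →L[ℂ] ℂ}
    (hω : LinearIndependent ℂ ω) : ∃ v : Fin q → E, ∀ l m, ω l (v m) = if l = m then 1 else 0 := by
  have key : ∀ m, ∃ v : E, ω m v = 1 ∧ ∀ l ≠ m, ω l v = 0 := by
    intro m
    have hω' : LinearIndependent ℂ fun l => (ω l : E →ₗ[ℂ] ℂ) :=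
      hω.map' (ContinuousLinearMap.coeLM ℂ : (E →L[ℂ] ℂ) →ₗ[ℂ] (E →ₗ[ℂ] ℂ))
        (LinearMap.ker_eq_bot.mpr ContinuousLinearMap.coe_injective)
    have hns := linearIndependent_iff_notMem_span.mp hω' m
    have h2 : ¬ (⨅ l : {l : Fin q // l ≠ m}, LinearMap.ker (ω l : E →ₗ[ℂ] ℂ))
        ≤ LinearMap.ker (ω m : E →ₗ[ℂ] ℂ) := by
      intro hle
      refine hns (Submodule.span_mono ?_ (mem_span_of_iInf_ker_le_ker hle))
      rintro _ ⟨⟨l, hl⟩, rfl⟩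
      exact ⟨l, ⟨Set.mem_univ l, hl⟩, rfl⟩
    obtain ⟨v, hv, hvm⟩ := SetLike.not_le_iff_exists.mp h2
    simp only [Submodule.mem_iInf, LinearMap.mem_ker, Subtype.forall] at hv hvm
    refine ⟨(ω m v)⁻¹ • v, ?_, fun l hl => ?_⟩
    · rw [map_smul, smul_eq_mul]
      exact inv_mul_cancel₀ hvm
    · rw [map_smul]
      have := hv l hl
      simp only [ContinuousLinearMap.coe_coe] at this
      rw [this, smul_zero]
  choose v hv1 hv2 using key
  refine ⟨v, fun l m => ?_⟩
  split_ifs with h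
  · rw [h, hv1]
  · exact hv2 m l h

theorem AnalyticAt.exists_local_inverse [CompleteSpace E] {F : Type*} [NormedAddCommGroup F]
    [NormedSpace ℂ F] [CompleteSpace F] {Ψ : E → F} (hΨ : AnalyticAt ℂ Ψ 0) (h0 : Ψ 0 = 0)
    (e : E ≃L[ℂ] F) (he : HasFDerivAt Ψ (e : E →L[ℂ] F) 0) :
    ∃ Φ : F → E, AnalyticAt ℂ Φ 0 ∧ Φ 0 = 0 ∧ (∀ᶠ x in 𝓝 (0 : E), Φ (Ψ x) = x) ∧
      ∀ᶠ y in 𝓝 (0 : F), Ψ (Φ y) = y := by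
  have hs : HasStrictFDerivAt Ψ (e : E →L[ℂ] F) 0 := by
    have := hΨ.hasStrictFDerivAt
    rwa [he.fderiv] at this
  refine ⟨hs.localInverse Ψ e 0, ?_, ?_, hs.eventually_left_inverse, ?_⟩
  · have h1 := OpenPartialHomeomorph.analyticAt_symm' (hs.toOpenPartialHomeomorph Ψ)
      hs.mem_toOpenPartialHomeomorph_source (i := e) (by simpa using hΨ) (by simpa using he.fderiv)
    simp only [HasStrictFDerivAt.toOpenPartialHomeomorph_coe, h0] at h1
    exact h1
  · have := hs.localInverse_apply_image
    rwa [h0] at this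
  · have := hs.eventually_right_inverse
    rwa [h0] at this

theorem exists_straightening [CompleteSpace E] {q : ℕ} {w : Fin q → E → ℂ}
    (hw : ∀ l, AnalyticAt ℂ (w l) 0) (hw0 : ∀ l, w l 0 = 0) {v : Fin q → E}
    (hv : ∀ l m, fderiv ℂ (w l) 0 (v m) = if l = m then 1 else 0) :
    ∃ Ψ Φ : E → E, AnalyticAt ℂ Ψ 0 ∧ AnalyticAt ℂ Φ 0 ∧ Ψ 0 = 0 ∧ Φ 0 = 0 ∧
      (∀ᶠ x in 𝓝 (0 : E), Φ (Ψ x) = x) ∧ (∀ᶠ x in 𝓝 (0 : E), Ψ (Φ x) = x) ∧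
      ∀ l x, fderiv ℂ (w l) 0 (Ψ x) = w l x := by
  -- The correction has zero differential at `0`, so `Ψ` is tangent to the identity; pairing with a
  -- dual vector replaces the linear part of `w l` by `w l` itself.
  set Ψ : E → E := fun x => x + ∑ l, (w l x - fderiv ℂ (w l) 0 x) • v l with hΨ
  have hΨa : AnalyticAt ℂ Ψ 0 := by
    refine analyticAt_id.add (Finset.analyticAt_fun_sum _ fun l _ => ?_)
    exact ((hw l).sub ((fderiv ℂ (w l) 0).analyticAt 0)).smul analyticAt_const
  have hΨ0 : Ψ 0 = 0 := by simp [hΨ, hw0]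
  have hd : HasFDerivAt Ψ ((ContinuousLinearEquiv.refl ℂ E : E ≃L[ℂ] E) : E →L[ℂ] E) 0 := by
    have h1 : ∀ l ∈ Finset.univ, HasFDerivAt (fun x => (w l x - fderiv ℂ (w l) 0 x) • v l)
        (0 : E →L[ℂ] E) 0 := by
      intro l _
      have h2 := ((hw l).differentiableAt.hasFDerivAt.fun_sub
        (fderiv ℂ (w l) 0).hasFDerivAt).smul_const (v l)
      simpa using h2
    have h3 := (hasFDerivAt_id (𝕜 := ℂ) (0 : E)).fun_add (HasFDerivAt.fun_sum h1)
    simpa using h3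
  obtain ⟨Φ, hΦa, hΦ0, h1, h2⟩ := hΨa.exists_local_inverse hΨ0 _ hd
  refine ⟨Ψ, Φ, hΨa, hΦa, hΨ0, hΦ0, h1, h2, fun l x => ?_⟩
  simp [hΨ, hv]

/-- After cancelling `ω l ^ m l`, an excess power of `ω l` would make the remaining product vanish
on `ker (ω l)`. It does not vanish near `0` along a direction in that kernel on which every other
form equals one. -/
theorem pow_dvd_le_of_factorization {q : ℕ} {ω : Fin q → E →L[ℂ] ℂ} {v : Fin q → E}
    (hv : ∀ l m, ω l (v m) = if l = m then 1 else 0) {m : Fin q → ℕ} {u g : E → ℂ}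
    (hu : AnalyticAt ℂ u 0) (hu0 : u 0 ≠ 0) (hg : AnalyticAt ℂ g 0) {l : Fin q} {n : ℕ}
    (h : ∀ᶠ x in 𝓝 (0 : E), u x * ∏ i, ω i x ^ m i = ω l x ^ n * g x) : n ≤ m l := by
  by_contra hn
  push Not at hn
  obtain ⟨j, rfl⟩ := Nat.exists_eq_add_of_lt hn
  have ha : ∀ i, AnalyticAt ℂ (fun x => ω i x) 0 := fun i => (ω i).analyticAt 0
  have h2 := ((ha l).pow (m l)).eventually_eq_zero_or_eventually_eq_zero
    (G := fun x => u x * ∏ i ∈ Finset.univ.erase l, ω i x ^ m i - ω l x ^ (j + 1) * g x)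
    ((hu.mul (Finset.analyticAt_fun_prod _ fun i _ => (ha i).pow _)).sub
      (((ha l).pow _).mul hg)) (by
      filter_upwards [h] with x hx
      rw [← Finset.mul_prod_erase _ _ (Finset.mem_univ l)] at hx
      simp only [Pi.pow_apply]
      rw [add_assoc, pow_add] at hx
      linear_combination hx)
  rcases h2 with h2 | h2
  · have := ((tendsto_smul_nhds_zero (v l)).eventually h2).filter_mono
      (nhdsWithin_le_nhds (s := {0}ᶜ))
    obtain ⟨t, ht, ht0⟩ := (this.and self_mem_nhdsWithin).exists
    have : t ^ m l = 0 := by simpa [hv] using ht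
    exact (pow_ne_zero _ ht0) this
  · set z : E := ∑ i ∈ Finset.univ.erase l, v i with hz
    have hzl : ω l z = 0 := by
      rw [hz, map_sum]
      exact Finset.sum_eq_zero fun i hi => by
        rw [hv, if_neg (Finset.ne_of_mem_erase hi).symm]
    have hzi : ∀ i ∈ Finset.univ.erase l, ω i z = 1 := fun i hi => by
      rw [hz, map_sum]
      simp only [hv]
      rw [Finset.sum_ite_eq, if_pos hi]
    have h3 := ((tendsto_smul_nhds_zero z).eventually
      (h2.and (hu.continuousAt.eventually_ne hu0))).filter_mono (nhdsWithin_le_nhds (s := {0}ᶜ))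
    obtain ⟨t, ⟨ht, htu⟩, ht0⟩ := (h3.and self_mem_nhdsWithin).exists
    rw [map_smul, hzl, smul_zero, zero_pow (Nat.succ_ne_zero j), zero_mul, sub_zero] at ht
    refine mul_ne_zero htu (Finset.prod_ne_zero_iff.mpr fun i hi => pow_ne_zero _ ?_) ht
    rw [map_smul, hzi i hi, smul_eq_mul, mul_one]
    exact ht0

end Factorization

theorem IsSNCAtZero.exists_factorization {d q : ℕ} {Z : Set (Fin d → ℂ)}
    {w : Fin q → (Fin d → ℂ) → ℂ} (hw : IsSNCAtZero Z w) {h : (Fin d → ℂ) → ℂ}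
    (hh : AnalyticAt ℂ h 0) (hne : ¬ ∀ᶠ x in 𝓝 (0 : Fin d → ℂ), h x = 0)
    (hz : ∀ᶠ x in 𝓝 (0 : Fin d → ℂ), h x = 0 → ∃ l, w l x = 0) :
    ∃ u : (Fin d → ℂ) → ℂ, AnalyticAt ℂ u 0 ∧ u 0 ≠ 0 ∧
      ∀ᶠ x in 𝓝 (0 : Fin d → ℂ), h x = u x * ∏ l, w l x ^ vanishingOrder (w l) h := by
  obtain ⟨v, hv⟩ := hw.transverse.exists_dual_vectors
  obtain ⟨Ψ, Φ, hΨ, hΦ, hΨ0, hΦ0, hΦΨ, hΨΦ, hωΨ⟩ := exists_straightening hw.analyticAt hw.map_zero hv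
  have htΨ : Tendsto Ψ (𝓝 0) (𝓝 0) := by simpa [hΨ0] using hΨ.continuousAt.tendsto
  have htΦ : Tendsto Φ (𝓝 0) (𝓝 0) := by simpa [hΦ0] using hΦ.continuousAt.tendsto
  set ω : Fin q → (Fin d → ℂ) →L[ℂ] ℂ := fun l => fderiv ℂ (w l) 0 with hω
  have hwΦ : ∀ᶠ y in 𝓝 (0 : Fin d → ℂ), ∀ l, w l (Φ y) = ω l y := by
    filter_upwards [hΨΦ] with y hy l
    rw [← hωΨ, hy]
  have hhΦ : AnalyticAt ℂ (fun y => h (Φ y)) 0 := AnalyticAt.comp (f := Φ) (by rwa [hΦ0]) hΦ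
  have hzΦ : ∀ᶠ y in 𝓝 (0 : Fin d → ℂ), h (Φ y) = 0 → ∃ l, ω l y = 0 := by
    filter_upwards [htΦ.eventually hz, hwΦ] with y hy hy' h0
    obtain ⟨l, hl⟩ := hy h0
    exact ⟨l, by rw [← hy', hl]⟩
  have hneΦ : ¬ ∀ᶠ y in 𝓝 (0 : Fin d → ℂ), h (Φ y) = 0 := by
    intro hcon
    refine hne ?_
    filter_upwards [htΨ.eventually hcon, hΦΨ] with x hx hx'
    rwa [hx'] at hx
  obtain ⟨R, hR, hRa⟩ := Metric.eventually_nhds_iff_ball.mp (hhΦ.eventually_analyticAt.and hzΦ)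
  -- A direction is needed along which `h` is not identically zero and which meets every hyperplane
  -- transversely. Failing this, the product of `h ∘ Φ` (the index `none`) and all the forms would
  -- vanish identically.
  obtain ⟨x₁, hx₁R, hx₁, hωx₁⟩ : ∃ x₁ ∈ Metric.ball (0 : Fin d → ℂ) R, h (Φ x₁) ≠ 0 ∧
      ∀ l, ω l x₁ ≠ 0 := by
    by_contra hcon
    push Not at hcon
    have hprod : ∀ᶠ x in 𝓝 (0 : Fin d → ℂ), ∏ i : Option (Fin q),
        (i.elim (h (Φ x)) fun l => ω l x) = 0 := by
      filter_upwards [Metric.ball_mem_nhds 0 hR] with x hx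
      by_cases hx0 : h (Φ x) = 0
      · exact Finset.prod_eq_zero (Finset.mem_univ none) hx0
      · obtain ⟨l, hl⟩ := hcon x hx hx0
        exact Finset.prod_eq_zero (Finset.mem_univ (some l)) hl
    obtain ⟨i, -, hi⟩ := AnalyticAt.exists_eventually_eq_zero_of_prod Finset.univ
      (F := fun (i : Option (Fin q)) x => i.elim (h (Φ x)) fun l => ω l x)
      (fun i _ => by
        cases i with
        | none => exact hhΦ
        | some l => exact (ω l).analyticAt 0) hprod
    cases i with
    | none => exact hneΦ hi
    | some l =>
      obtain ⟨t, ht, ht0⟩ := ((((tendsto_smul_nhds_zero (v l)).eventually hi).filter_mono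
        (nhdsWithin_le_nhds (s := {0}ᶜ))).and self_mem_nhdsWithin).exists
      have : t = 0 := by simpa [hω, hv] using ht
      exact ht0 this
  have hline : AnalyticOnNhd ℂ (fun t : ℂ => h (Φ (t • x₁))) {t : ℂ | t • x₁ ∈ Metric.ball 0 R} := by
    intro t ht
    have h1 := (hRa _ ht).1
    exact AnalyticAt.comp (f := fun t : ℂ => t • x₁) h1 (by fun_prop)
  have hconv : IsPreconnected {t : ℂ | t • x₁ ∈ Metric.ball (0 : Fin d → ℂ) R} := by
    have : Convex ℝ ((LinearMap.toSpanSingleton ℂ (Fin d → ℂ) x₁).restrictScalars ℝ ⁻¹'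
      Metric.ball (0 : Fin d → ℂ) R) := (convex_ball _ _).linear_preimage _
    exact this.isPreconnected
  have h0mem : (0 : ℂ) ∈ {t : ℂ | t • x₁ ∈ Metric.ball (0 : Fin d → ℂ) R} := by simpa using hR
  have hnz : ¬ ∀ᶠ t in 𝓝 (0 : ℂ), h (Φ (t • x₁)) = 0 := by
    intro hcon
    have := hline.eqOn_zero_of_preconnected_of_eventuallyEq_zero hconv h0mem hcon
      (show (1 : ℂ) ∈ _ by simpa using hx₁R)
    simp only [one_smul, Pi.zero_apply] at this
    exact hx₁ this
  obtain ⟨M, k, hk, hk0, hMk⟩ :=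
    ((hline 0 h0mem).exists_eventuallyEq_pow_smul_nonzero_iff).mpr hnz
  obtain ⟨m, u, hu, hu0, hfac⟩ := AnalyticAt.exists_factorization_linear hωx₁ (M := M)
    hk.continuousAt hk0 hhΦ
    (hMk.filter_mono nhdsWithin_le_nhds |>.mono fun t ht => by simpa using ht) hzΦ
  have hfac' : ∀ᶠ x in 𝓝 (0 : Fin d → ℂ), h x = u (Ψ x) * ∏ l, w l x ^ m l := by
    filter_upwards [htΨ.eventually hfac, hΦΨ] with x hx hx'
    rw [hx'] at hx
    rw [hx]
    simp only [hω, hωΨ]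
  have huΨ : AnalyticAt ℂ (fun x => u (Ψ x)) 0 := AnalyticAt.comp (f := Ψ) (by rwa [hΨ0]) hΨ
  have hm : ∀ l, vanishingOrder (w l) h = m l := by
    intro l
    refine IsGreatest.csSup_eq ⟨⟨fun x => u (Ψ x) * ∏ i ∈ Finset.univ.erase l, w i x ^ m i,
      huΨ.mul (Finset.analyticAt_fun_prod _ fun i _ => (hw.analyticAt i).pow _), ?_⟩, ?_⟩
    · filter_upwards [hfac'] with x hx
      rw [hx, ← Finset.mul_prod_erase _ _ (Finset.mem_univ l)]
      ring
    · rintro n ⟨g, hg, hgn⟩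
      refine pow_dvd_le_of_factorization hv hu hu0 (g := fun y => g (Φ y))
        (AnalyticAt.comp (f := Φ) (by rwa [hΦ0]) hΦ) ?_
      filter_upwards [hfac, htΦ.eventually hgn, hwΦ] with y h1 h2 h3
      rw [← h1, h2, h3]
  refine ⟨fun x => u (Ψ x), huΨ, by simpa [hΨ0] using hu0, ?_⟩
  filter_upwards [hfac'] with x hx
  simp only [hm]
  exact hx

/-! ### Triangular bases ordered by the modulus of the eigenvalues -/

/-- For an eigenvalue `μ` of maximal modulus, `T - μ` is not surjective, so some non-zero form `φ`
satisfies `φ ∘ T = μ φ`. Its kernel is an invariant hyperplane to which induction applies; any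
vector outside it comes first. Using a left eigenvector puts the largest eigenvalue on the quotient,
whence lower triangular with decreasing moduli. -/
theorem Module.End.exists_basis_lowerTriangular {n : ℕ} {V : Type*} [AddCommGroup V] [Module ℂ V]
    [FiniteDimensional ℂ V] (hn : Module.finrank ℂ V = n) (T : Module.End ℂ V) :
    ∃ (b : Module.Basis (Fin n) ℂ V) (μ : Fin n → ℂ), (∀ i j, i ≤ j → ‖μ j‖ ≤ ‖μ i‖) ∧
      (∀ i, T.HasEigenvalue (μ i)) ∧
      ∀ i, T (b i) - μ i • b i ∈ Submodule.span ℂ (b '' Set.Ioi i) := by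
  induction n generalizing V with
  | zero => exact ⟨Module.finBasisOfFinrankEq ℂ V hn, Fin.elim0, fun i => i.elim0, fun i => i.elim0,
      fun i => i.elim0⟩
  | succ n ih =>
    have : Nontrivial V := Module.nontrivial_of_finrank_pos (R := ℂ) (by omega)
    obtain ⟨μ₀, hμ₀⟩ := Module.End.exists_eigenvalue T
    have hfin : {μ : ℂ | T.HasEigenvalue μ}.Finite := T.finite_hasEigenvalue
    obtain ⟨μ, hμ, hmax⟩ := hfin.exists_maximalFor (fun μ => ‖μ‖) _ ⟨μ₀, hμ₀⟩
    have hmax' : ∀ ν, T.HasEigenvalue ν → ‖ν‖ ≤ ‖μ‖ := fun ν hν => by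
      rcases le_total ‖ν‖ ‖μ‖ with h | h
      · exact h
      · exact hmax hν h
    have hlt : LinearMap.range (T - algebraMap ℂ (Module.End ℂ V) μ) < ⊤ := by
      rw [lt_top_iff_ne_top]
      intro htop
      have hinj := LinearMap.ker_eq_bot_iff_range_eq_top.mpr htop
      obtain ⟨x, hx⟩ := Module.End.HasEigenvalue.exists_hasEigenvector hμ
      refine hx.2 ?_
      have : x ∈ LinearMap.ker (T - algebraMap ℂ (Module.End ℂ V) μ) := by
        rw [LinearMap.mem_ker]
        simp [hx.apply_eq_smul, Module.algebraMap_end_apply]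
      rwa [hinj, Submodule.mem_bot] at this
    obtain ⟨φ, hφ0, hφ⟩ := Submodule.exists_le_ker_of_lt_top _ hlt
    have hTφ : ∀ x, T x - μ • x ∈ LinearMap.ker φ := fun x => hφ ⟨x, by
      simp [Module.algebraMap_end_apply]⟩
    have hinv : ∀ x ∈ LinearMap.ker φ, T x ∈ LinearMap.ker φ := by
      intro x hx
      have := Submodule.add_mem _ (hTφ x) (Submodule.smul_mem _ μ hx)
      simpa using this
    have hfr : Module.finrank ℂ (LinearMap.ker φ) = n := by
      have := Module.Dual.finrank_ker_add_one_of_ne_zero hφ0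
      omega
    obtain ⟨b, ν, hν, hνe, hb⟩ := ih hfr (T.restrict hinv)
    obtain ⟨y, hy⟩ : ∃ y, φ y ≠ 0 := by
      by_contra hcon
      push Not at hcon
      exact hφ0 (LinearMap.ext hcon)
    have hνT : ∀ i, T.HasEigenvalue (ν i) := by
      intro i
      obtain ⟨x, hx⟩ := (hνe i).exists_hasEigenvector
      refine Module.End.hasEigenvalue_of_hasEigenvector (x := (x : V)) ⟨?_, ?_⟩
      · rw [Module.End.mem_eigenspace_iff]
        have := congrArg Subtype.val hx.apply_eq_smul
        simpa using this
      · exact fun h => hx.2 (Subtype.ext h)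
    refine ⟨Module.Basis.mkFinCons y b ?_ ?_, Fin.cons μ ν, ?_, ?_, ?_⟩
    · intro c x hx hcx
      have := congrArg φ hcx
      rw [map_add, map_smul, LinearMap.mem_ker.mp hx, map_zero, add_zero, smul_eq_mul] at this
      exact (mul_eq_zero.mp this).resolve_right hy
    · intro z
      refine ⟨-(φ z / φ y), ?_⟩
      rw [LinearMap.mem_ker, map_add, map_smul, smul_eq_mul]
      field_simp
      ring
    · intro i j hij
      cases i using Fin.cases with
      | zero =>
        cases j using Fin.cases with
        | zero => exact le_rfl
        | succ j => simpa using hmax' _ (hνT j)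
      | succ i =>
        cases j using Fin.cases with
        | zero => exact absurd hij (by simp)
        | succ j => simpa using hν i j (by simpa using hij)
    · intro i
      cases i using Fin.cases with
      | zero => exact hμ
      | succ i => exact hνT i
    · intro i
      rw [Module.Basis.coe_mkFinCons]
      cases i using Fin.cases with
      | zero =>
        have h1 : (⟨T y - μ • y, hTφ y⟩ : LinearMap.ker φ) ∈ Submodule.span ℂ (Set.range b) := by
          rw [b.span_eq]; trivial
        have h2 := Submodule.mem_map_of_mem (f := (LinearMap.ker φ).subtype) h1
        rw [Submodule.map_span] at h2
        refine Submodule.span_mono ?_ h2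
        rintro _ ⟨_, ⟨j, rfl⟩, rfl⟩
        exact ⟨j.succ, by simp, by simp⟩
      | succ i =>
        have h2 := Submodule.mem_map_of_mem (f := (LinearMap.ker φ).subtype) (hb i)
        rw [Submodule.map_span] at h2
        simp only [Fin.cons_succ, Function.comp_apply]
        refine Submodule.span_mono ?_ (by simpa using h2)
        rintro _ ⟨_, ⟨j, hj, rfl⟩, rfl⟩
        exact ⟨j.succ, by simpa using hj, by simp⟩

/-- A basis in which `T` is lower triangular, with the eigenvalues ordered by decreasing modulus;
the first `s` eigenvalues are the non-zero ones. -/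
structure IsAdaptedBasis {d : ℕ} (T : Module.End ℂ (Fin d → ℂ))
    (b : Module.Basis (Fin d) ℂ (Fin d → ℂ)) (μ : Fin d → ℂ) (s : ℕ) : Prop where
  antitone : ∀ i j, i ≤ j → ‖μ j‖ ≤ ‖μ i‖
  hasEigenvalue : ∀ i, T.HasEigenvalue (μ i)
  mem_span : ∀ i, T (b i) - μ i • b i ∈ Submodule.span ℂ (b '' Set.Ioi i)
  ne_zero_iff : ∀ i, μ i ≠ 0 ↔ (i : ℕ) < s

theorem Module.Basis.coord_eq_zero_of_mem_span_image {ι V : Type*} [AddCommGroup V] [Module ℂ V]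
    (b : Module.Basis ι ℂ V) {S : Set ι} {x : V} (hx : x ∈ Submodule.span ℂ (b '' S)) {j : ι}
    (hj : j ∉ S) : b.coord j x = 0 := by
  classical
  have : Submodule.span ℂ (b '' S) ≤ LinearMap.ker (b.coord j) := by
    rw [Submodule.span_le]
    rintro _ ⟨i, hi, rfl⟩
    rw [SetLike.mem_coe, LinearMap.mem_ker, b.coord_apply, b.repr_self, Finsupp.single_apply,
      if_neg (fun h => hj (by rwa [← h]))]
  exact this hx

namespace IsAdaptedBasis

variable {d s : ℕ} {T : Module.End ℂ (Fin d → ℂ)} {b : Module.Basis (Fin d) ℂ (Fin d → ℂ)}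
  {μ : Fin d → ℂ}

theorem coord_of_le (hb : IsAdaptedBasis T b μ s) {i j : Fin d} (hij : j ≤ i) :
    b.coord j (T (b i)) = if j = i then μ i else 0 := by
  have h := b.coord_eq_zero_of_mem_span_image (hb.mem_span i) (j := j) (by simpa using hij)
  rw [map_sub, map_smul, sub_eq_zero] at h
  rw [h, b.coord_apply, b.repr_self, Finsupp.single_apply]
  by_cases hj : j = i
  · simp [hj]
  · simp [hj, Ne.symm hj]

theorem coord_apply (hb : IsAdaptedBasis T b μ s) (j : Fin d) (x : Fin d → ℂ) :
    b.coord j (T x) =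
      μ j * b.coord j x + ∑ i ∈ Finset.univ.filter (· < j), b.coord j (T (b i)) * b.coord i x := by
  conv_lhs => rw [← b.sum_repr x]
  simp only [map_sum, map_smul, smul_eq_mul]
  have h1 : ∀ i, b.repr x i * b.coord j (T (b i)) = (if j = i then μ j * b.coord j x else 0) +
      (if i < j then b.coord j (T (b i)) * b.coord i x else 0) := by
    intro i
    rcases lt_trichotomy i j with h | h | h
    · rw [if_neg h.ne', if_pos h, zero_add, mul_comm, b.coord_apply i]
    · subst h
      rw [hb.coord_of_le le_rfl]
      simp [mul_comm]
    · rw [hb.coord_of_le h.le, if_neg h.ne, if_neg h.ne, if_neg h.not_gt]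
      simp
  simp only [h1, Finset.sum_add_distrib, Finset.sum_ite_eq, Finset.mem_univ, if_true,
    Finset.sum_filter]

/-- By descending induction these basis vectors lie in the generalized eigenspace of `0`, since `T`
sends each into the span of the later ones. -/
theorem apply_eq_zero (hb : IsAdaptedBasis T b μ s)
    (hnil : ∀ v ∈ T.maxGenEigenspace 0, T v = 0) {i : Fin d} (hi : s ≤ i) : T (b i) = 0 := by
  refine hnil _ ?_
  induction i using WellFoundedGT.induction with
  | ind i ih =>
    have hμ : μ i = 0 := by
      by_contra h
      exact absurd ((hb.ne_zero_iff i).mp h) (by omega)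
    have h1 := hb.mem_span i
    rw [hμ, zero_smul, sub_zero] at h1
    have h2 : Submodule.span ℂ (b '' Set.Ioi i) ≤ T.maxGenEigenspace 0 := by
      rw [Submodule.span_le]
      rintro _ ⟨j, hj, rfl⟩
      have hj' : i < j := hj
      exact ih j hj' (hi.trans (Fin.le_def.mp hj'.le))
    obtain ⟨k, hk⟩ := (Module.End.mem_maxGenEigenspace _ _ _).mp (h2 h1)
    refine (Module.End.mem_maxGenEigenspace _ _ _).mpr ⟨k + 1, ?_⟩
    simp only [zero_smul, sub_zero] at hk ⊢
    rw [pow_succ, Module.End.mul_apply, hk]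

end IsAdaptedBasis

/-- The triangular matrix identifies the roots of the characteristic polynomial, with multiplicity,
with the family `μ`; monotone moduli make the non-zero ones an initial segment. -/
theorem exists_isAdaptedBasis {d : ℕ} (T : Module.End ℂ (Fin d → ℂ)) :
    ∃ b μ, IsAdaptedBasis T b μ (T.charpoly.roots.filter (fun μ : ℂ => μ ≠ 0)).card := by
  obtain ⟨b, μ, hμ, he, hsp⟩ := T.exists_basis_lowerTriangular (n := d) (by simp)
  refine ⟨b, μ, hμ, he, hsp, ?_⟩
  have hM : ∀ i j, j ≤ i → b.coord j (T (b i)) = if j = i then μ i else 0 := by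
    intro i j hij
    have h := b.coord_eq_zero_of_mem_span_image (hsp i) (j := j) (by simpa using hij)
    rw [map_sub, map_smul, sub_eq_zero] at h
    rw [h, b.coord_apply, b.repr_self, Finsupp.single_apply]
    by_cases hj : j = i
    · simp [hj]
    · simp [hj, Ne.symm hj]
  have hcp : T.charpoly = ∏ i, (Polynomial.X - Polynomial.C (μ i)) := by
    rw [← LinearMap.charpoly_toMatrix T b, ← Matrix.charpoly_transpose,
      Matrix.charpoly_of_isUpperTriangular]
    · refine Finset.prod_congr rfl fun i _ => ?_
      rw [Matrix.transpose_apply, LinearMap.toMatrix_apply, ← b.coord_apply, hM i i le_rfl,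
        if_pos rfl]
    · intro i j hij
      have hij' : j < i := hij
      rw [Matrix.transpose_apply, LinearMap.toMatrix_apply, ← b.coord_apply, hM i j hij'.le,
        if_neg hij'.ne]
  have hroots : T.charpoly.roots = Finset.univ.val.map μ := by
    have : T.charpoly = ((Finset.univ.val.map μ).map fun a => Polynomial.X - Polynomial.C a).prod := by
      rw [hcp, Multiset.map_map]
      rfl
    rw [this, Polynomial.roots_multiset_prod_X_sub_C]
  have hcard : (T.charpoly.roots.filter (fun μ : ℂ => μ ≠ 0)).card
      = (Finset.univ.filter fun i => μ i ≠ 0).card := by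
    rw [hroots, Multiset.filter_map, Multiset.card_map]
    rfl
  intro i
  rw [hcard]
  constructor
  · intro hi
    have : Finset.Iic i ⊆ Finset.univ.filter fun i => μ i ≠ 0 := by
      intro j hj
      rw [Finset.mem_Iic] at hj
      have := hμ j i hj
      rw [Finset.mem_filter]
      exact ⟨Finset.mem_univ _, norm_pos_iff.mp ((norm_pos_iff.mpr hi).trans_le this)⟩
    have := Finset.card_le_card this
    rw [Fin.card_Iic] at this
    omega
  · intro hi h0
    have : (Finset.univ.filter fun i => μ i ≠ 0) ⊆ Finset.Iio i := by
      intro j hj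
      rw [Finset.mem_filter] at hj
      rw [Finset.mem_Iio]
      by_contra hcon
      push Not at hcon
      have := hμ i j hcon
      rw [h0, norm_zero] at this
      exact hj.2 (norm_le_zero_iff.mp this)
    have := Finset.card_le_card this
    rw [Fin.card_Iio] at this
    omega

/-! ### Forward invariant neighbourhoods of a contracting germ -/

/-- Scaling the `i`-th coordinate by `δ ^ i` multiplies each strictly triangular entry by a positive
power of `δ`, making the off-diagonal part negligible. -/
theorem IsAdaptedBasis.exists_contracting_equiv {d s : ℕ} {T : Module.End ℂ (Fin d → ℂ)}
    {b : Module.Basis (Fin d) ℂ (Fin d → ℂ)} {μ : Fin d → ℂ} (hb : IsAdaptedBasis T b μ s)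
    (hμ : ∀ i, ‖μ i‖ < 1) :
    ∃ (e : (Fin d → ℂ) ≃L[ℂ] (Fin d → ℂ)) (ρ : ℝ), 0 ≤ ρ ∧ ρ < 1 ∧
      ∀ x, ‖e (T x)‖ ≤ ρ * ‖e x‖ := by
  obtain ⟨r, hr0, hr1, hr⟩ : ∃ r : ℝ, 0 ≤ r ∧ r < 1 ∧ ∀ i, ‖μ i‖ ≤ r := by
    rcases isEmpty_or_nonempty (Fin d) with h | h
    · exact ⟨0, le_rfl, one_pos, fun i => h.elim i⟩
    · obtain ⟨i, hi⟩ := Finite.exists_max fun i => ‖μ i‖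
      exact ⟨‖μ i‖, norm_nonneg _, hμ i, hi⟩
  set C : ℝ := ∑ j, ∑ i, ‖b.coord j (T (b i))‖ with hC
  have hC0 : 0 ≤ C := Finset.sum_nonneg fun j _ => Finset.sum_nonneg fun i _ => norm_nonneg _
  set δ : ℝ := (1 - r) / (2 * (C + 1)) with hδ
  have hδ0 : 0 < δ := div_pos (by linarith) (by linarith)
  have hδ1 : δ ≤ 1 := by
    rw [hδ, div_le_one (by linarith)]
    linarith
  have hδC : δ * C ≤ (1 - r) / 2 := by
    rw [hδ, div_mul_eq_mul_div, div_le_div_iff₀ (by linarith) two_pos]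
    nlinarith
  have hδc : (δ : ℂ) ≠ 0 := by exact_mod_cast hδ0.ne'
  let e₀ : (Fin d → ℂ) ≃ₗ[ℂ] (Fin d → ℂ) := b.equivFun.trans
    (LinearEquiv.piCongrRight fun i : Fin d => LinearEquiv.smulOfNeZero ℂ ℂ ((δ : ℂ) ^ (i : ℕ))
      (pow_ne_zero _ hδc))
  let e := e₀.toContinuousLinearEquiv
  have he : ∀ x i, e x i = (δ : ℂ) ^ (i : ℕ) * b.coord i x := fun x i => rfl
  refine ⟨e, r + (1 - r) / 2, by linarith, by linarith, fun x => ?_⟩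
  rw [pi_norm_le_iff_of_nonneg (mul_nonneg (by linarith) (norm_nonneg _))]
  intro j
  have hx : ∀ i : Fin d, δ ^ (i : ℕ) * ‖b.coord i x‖ ≤ ‖e x‖ := by
    intro i
    have := norm_le_pi_norm (e x) i
    rwa [he, norm_mul, norm_pow, Complex.norm_real, Real.norm_of_nonneg hδ0.le] at this
  rw [he, norm_mul, norm_pow, Complex.norm_real, Real.norm_of_nonneg hδ0.le, hb.coord_apply]
  have h1 : ∀ i ∈ Finset.univ.filter (· < j),
      δ ^ (j : ℕ) * ‖b.coord j (T (b i)) * b.coord i x‖ ≤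
        ‖b.coord j (T (b i))‖ * (δ * ‖e x‖) := by
    intro i hi
    have hij : (i : ℕ) < j := (Finset.mem_filter.mp hi).2
    obtain ⟨k, hk⟩ := Nat.exists_eq_add_of_lt hij
    rw [norm_mul, hk]
    calc _ = ‖b.coord j (T (b i))‖ * (δ ^ k * δ * (δ ^ (i : ℕ) * ‖b.coord i x‖)) := by ring
      _ ≤ ‖b.coord j (T (b i))‖ * (1 * δ * ‖e x‖) := by
        gcongr
        · exact pow_le_one₀ hδ0.le hδ1
        · exact hx i
      _ = _ := by ring
  calc _ ≤ δ ^ (j : ℕ) * (‖μ j * b.coord j x‖ +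
        ∑ i ∈ Finset.univ.filter (· < j), ‖b.coord j (T (b i)) * b.coord i x‖) := by
        gcongr
        exact (norm_add_le _ _).trans (add_le_add le_rfl (norm_sum_le _ _))
    _ = ‖μ j‖ * (δ ^ (j : ℕ) * ‖b.coord j x‖) + ∑ i ∈ Finset.univ.filter (· < j),
        δ ^ (j : ℕ) * ‖b.coord j (T (b i)) * b.coord i x‖ := by
        rw [mul_add, Finset.mul_sum, norm_mul]; ring
    _ ≤ r * ‖e x‖ + ∑ i ∈ Finset.univ.filter (· < j),
        ‖b.coord j (T (b i))‖ * (δ * ‖e x‖) := by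
        refine add_le_add ?_ (Finset.sum_le_sum h1)
        gcongr
        · exact hr j
        · exact hx j
    _ ≤ r * ‖e x‖ + C * (δ * ‖e x‖) := by
        rw [← Finset.sum_mul]
        gcongr
        calc _ ≤ ∑ i, ‖b.coord j (T (b i))‖ :=
              Finset.sum_le_sum_of_subset_of_nonneg (Finset.filter_subset _ _)
                fun i _ _ => norm_nonneg _
          _ ≤ C := Finset.single_le_sum (f := fun j => ∑ i, ‖b.coord j (T (b i))‖)
              (fun j _ => Finset.sum_nonneg fun i _ => norm_nonneg _) (Finset.mem_univ j)
    _ ≤ _ := by nlinarith [norm_nonneg (e x)]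

/-- The sets `‖e x‖ < r'` work, as the nonlinear part is `o(x)`. The rate and constant are chosen
before `U`, which later arguments rely on when they shrink the neighbourhood. -/
theorem exists_invariant_nhds {E : Type*} [NormedAddCommGroup E] [NormedSpace ℂ E] {f : E → E}
    (hf : DifferentiableAt ℂ f 0) (hf0 : f 0 = 0) (e : E ≃L[ℂ] E) {ρ₀ : ℝ} (hρ₀ : 0 ≤ ρ₀)
    (hρ₁ : ρ₀ < 1) (he : ∀ x, ‖e (fderiv ℂ f 0 x)‖ ≤ ρ₀ * ‖e x‖) :
    ∃ ρ C : ℝ, 0 < ρ ∧ ρ < 1 ∧ 0 < C ∧ ∀ U ∈ 𝓝 (0 : E), ∃ V ⊆ U, IsOpen V ∧ (0 : E) ∈ V ∧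
      Set.MapsTo f V V ∧ ∀ x ∈ V, ∀ n, ‖f^[n] x‖ ≤ C * ρ ^ n * ‖x‖ := by
  set a : ℝ := ‖(e : E →L[ℂ] E)‖
  set a' : ℝ := ‖(e.symm : E →L[ℂ] E)‖
  have hea : ∀ x, ‖e x‖ ≤ a * ‖x‖ := fun x => (e : E →L[ℂ] E).le_opNorm x
  have hea' : ∀ x, ‖x‖ ≤ a' * ‖e x‖ := fun x => by
    simpa using (e.symm : E →L[ℂ] E).le_opNorm (e x)
  have ha : 0 ≤ a := norm_nonneg _
  have ha' : 0 ≤ a' := norm_nonneg _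
  set ε : ℝ := (1 - ρ₀) / 2 / (a * a' + 1) with hε
  have hε0 : 0 < ε := by
    have := mul_nonneg ha ha'
    exact div_pos (by linarith) (by linarith)
  have hεa : ε * (a * a') ≤ (1 - ρ₀) / 2 := by
    have := mul_nonneg ha ha'
    rw [hε, div_mul_eq_mul_div, div_le_iff₀ (by linarith)]
    nlinarith
  set ρ : ℝ := ρ₀ + (1 - ρ₀) / 2 with hρ
  have hρpos : 0 < ρ := by rw [hρ]; linarith
  have hstep : ∀ᶠ x in 𝓝 (0 : E), ‖e (f x)‖ ≤ ρ * ‖e x‖ := by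
    have h1 := hf.hasFDerivAt.isLittleO.def hε0
    filter_upwards [h1] with x hx
    rw [hf0, sub_zero, sub_zero] at hx
    have h2 : e (f x) = e (fderiv ℂ f 0 x) + e (f x - fderiv ℂ f 0 x) := by
      rw [← map_add]; congr 1; abel
    calc ‖e (f x)‖ ≤ ‖e (fderiv ℂ f 0 x)‖ + ‖e (f x - fderiv ℂ f 0 x)‖ := by
          rw [h2]; exact norm_add_le _ _
      _ ≤ ρ₀ * ‖e x‖ + a * (ε * (a' * ‖e x‖)) := by
          refine add_le_add (he x) ((hea _).trans ?_)
          gcongr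
          exact hx.trans (by gcongr; exact hea' x)
      _ = ρ₀ * ‖e x‖ + ε * (a * a') * ‖e x‖ := by ring
      _ ≤ ρ₀ * ‖e x‖ + (1 - ρ₀) / 2 * ‖e x‖ := by gcongr
      _ = ρ * ‖e x‖ := by rw [hρ]; ring
  refine ⟨ρ, a' * a + 1, hρpos, by rw [hρ]; linarith, by positivity, fun U hU => ?_⟩
  obtain ⟨r, hr, hrU⟩ := Metric.mem_nhds_iff.mp (Filter.inter_mem hU hstep)
  set r' : ℝ := r / (a' + 1)
  have hr' : 0 < r' := by positivity
  have hsub : ∀ x, ‖e x‖ < r' → x ∈ Metric.ball (0 : E) r := by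
    intro x hx
    rw [mem_ball_zero_iff]
    rw [lt_div_iff₀ (by positivity)] at hx
    calc ‖x‖ ≤ a' * ‖e x‖ := hea' x
      _ ≤ ‖e x‖ * (a' + 1) := by nlinarith [norm_nonneg (e x)]
      _ < r := hx
  have hcontr : ∀ x, ‖e x‖ < r' → ‖e (f x)‖ ≤ ρ * ‖e x‖ := fun x hx => (hrU (hsub x hx)).2
  have hmaps : Set.MapsTo f {x | ‖e x‖ < r'} {x | ‖e x‖ < r'} := by
    intro x hx
    have h1 := hcontr x hx
    have : ρ * ‖e x‖ ≤ 1 * ‖e x‖ := by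
      gcongr
      rw [hρ]; linarith
    rw [one_mul] at this
    exact (h1.trans this).trans_lt hx
  refine ⟨{x | ‖e x‖ < r'}, fun x hx => (hrU (hsub x hx)).1,
    isOpen_lt (by fun_prop) continuous_const, by simpa using hr', hmaps, fun x hx n => ?_⟩
  have hit : ‖e (f^[n] x)‖ ≤ ρ ^ n * ‖e x‖ := by
    induction n with
    | zero => simp
    | succ n ih =>
      rw [Function.iterate_succ_apply', pow_succ']
      refine (hcontr _ (hmaps.iterate n hx)).trans ?_
      rw [mul_assoc]
      gcongr
  calc ‖f^[n] x‖ ≤ a' * (ρ ^ n * (a * ‖x‖)) := by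
        refine (hea' _).trans ?_
        gcongr
        exact hit.trans (by gcongr; exact hea x)
    _ = (a' * a) * ρ ^ n * ‖x‖ := by ring
    _ ≤ _ := by gcongr; linarith

/-! ### The cohomological equation -/

section Cohomological

variable {d : ℕ}

/-- Functions whose germ at `0` is holomorphic and vanishes to order at least `j`. -/
def vanishingSubmodule (d j : ℕ) : Submodule ℂ ((Fin d → ℂ) → ℂ) where
  carrier := {h | AnalyticAt ℂ h 0 ∧ h =O[𝓝 0] fun x => ‖x‖ ^ j}
  add_mem' := fun h₁ h₂ => ⟨h₁.1.add h₂.1, h₁.2.add h₂.2⟩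
  zero_mem' := ⟨analyticAt_const, Asymptotics.isBigO_zero _ _⟩
  smul_mem' := fun c _ h => ⟨analyticAt_const.smul h.1, h.2.const_smul_left c⟩

/-- Functions which near `0` are constant on the common level sets of `φ i`, `i < k`. -/
def leafwiseConstant (φ : Fin d → (Fin d → ℂ) → ℂ) (k : ℕ) : Submodule ℂ ((Fin d → ℂ) → ℂ) where
  carrier := {c | ∀ᶠ z : (Fin d → ℂ) × (Fin d → ℂ) in 𝓝 0,
    (∀ i : Fin d, (i : ℕ) < k → φ i z.1 = φ i z.2) → c z.1 = c z.2}
  add_mem' := fun h₁ h₂ => by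
    filter_upwards [h₁, h₂] with z h₁ h₂ hz
    simp [h₁ hz, h₂ hz]
  zero_mem' := by simp
  smul_mem' := fun c _ h => by
    filter_upwards [h] with z h hz
    simp [h hz]

theorem eventually_fst_snd {p : (Fin d → ℂ) → Prop} (h : ∀ᶠ x in 𝓝 (0 : Fin d → ℂ), p x) :
    ∀ᶠ z : (Fin d → ℂ) × (Fin d → ℂ) in 𝓝 0, p z.1 ∧ p z.2 :=
  ((continuous_fst.tendsto' (0 : (Fin d → ℂ) × (Fin d → ℂ)) 0 rfl).eventually h).and
    ((continuous_snd.tendsto' (0 : (Fin d → ℂ) × (Fin d → ℂ)) 0 rfl).eventually h)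

theorem mem_leafwiseConstant_of_eventually_zero {φ : Fin d → (Fin d → ℂ) → ℂ} {k : ℕ}
    {c : (Fin d → ℂ) → ℂ} (hc : ∀ᶠ x in 𝓝 (0 : Fin d → ℂ), c x = 0) :
    c ∈ leafwiseConstant φ k := by
  change ∀ᶠ z : (Fin d → ℂ) × (Fin d → ℂ) in 𝓝 0, _
  filter_upwards [eventually_fst_snd hc] with z hz _
  rw [hz.1, hz.2]

theorem isBigO_pow_norm_of_le {i j : ℕ} (hij : i ≤ j) :
    (fun x : Fin d → ℂ => ‖x‖ ^ j) =O[𝓝 0] fun x => ‖x‖ ^ i := by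
  refine Asymptotics.IsBigO.of_bound 1 ?_
  filter_upwards [Metric.ball_mem_nhds (0 : Fin d → ℂ) one_pos] with x hx
  rw [mem_ball_zero_iff] at hx
  rw [one_mul, norm_pow, norm_pow, norm_norm]
  exact pow_le_pow_of_le_one (norm_nonneg x) hx.le hij

theorem vanishingSubmodule_anti {i j : ℕ} (hij : i ≤ j) :
    vanishingSubmodule d j ≤ vanishingSubmodule d i :=
  fun _ h => ⟨h.1, h.2.trans (isBigO_pow_norm_of_le hij)⟩

theorem mul_mem_vanishingSubmodule {i j : ℕ} {g h : (Fin d → ℂ) → ℂ}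
    (hg : g ∈ vanishingSubmodule d i) (hh : h ∈ vanishingSubmodule d j) :
    g * h ∈ vanishingSubmodule d (i + j) := by
  refine ⟨hg.1.mul hh.1, ?_⟩
  simp only [pow_add]
  exact hg.2.mul hh.2

theorem prod_mem_vanishingSubmodule {ι : Type*} (s : Finset ι) {a : ι → (Fin d → ℂ) → ℂ}
    (ha : ∀ t ∈ s, a t ∈ vanishingSubmodule d 1) : ∏ t ∈ s, a t ∈ vanishingSubmodule d s.card := by
  classical
  induction s using Finset.induction_on with
  | empty =>
    exact ⟨analyticAt_const, Asymptotics.IsBigO.of_bound 1 (by simp)⟩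
  | insert t s ht ih =>
    rw [Finset.prod_insert ht, Finset.card_insert_of_notMem ht, add_comm]
    exact mul_mem_vanishingSubmodule (ha t (Finset.mem_insert_self t s))
      (ih fun i hi => ha i (Finset.mem_insert_of_mem hi))

theorem prod_sub_prod_mem_vanishingSubmodule {ι : Type*} (s : Finset ι)
    {a b : ι → (Fin d → ℂ) → ℂ} (ha : ∀ t ∈ s, a t ∈ vanishingSubmodule d 1)
    (hb : ∀ t ∈ s, b t ∈ vanishingSubmodule d 1)
    (hab : ∀ t ∈ s, a t - b t ∈ vanishingSubmodule d 2) :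
    ∏ t ∈ s, a t - ∏ t ∈ s, b t ∈ vanishingSubmodule d (s.card + 1) := by
  classical
  induction s using Finset.induction_on with
  | empty => simp
  | insert t s ht ih =>
    rw [Finset.prod_insert ht, Finset.prod_insert ht, Finset.card_insert_of_notMem ht]
    have h1 := mul_mem_vanishingSubmodule (hab t (Finset.mem_insert_self t s))
      (prod_mem_vanishingSubmodule s fun i hi => ha i (Finset.mem_insert_of_mem hi))
    have h2 := mul_mem_vanishingSubmodule (hb t (Finset.mem_insert_self t s))
      (ih (fun i hi => ha i (Finset.mem_insert_of_mem hi))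
        (fun i hi => hb i (Finset.mem_insert_of_mem hi))
        fun i hi => hab i (Finset.mem_insert_of_mem hi))
    rw [show 2 + s.card = s.card + 1 + 1 by ring] at h1
    rw [show 1 + (s.card + 1) = s.card + 1 + 1 by ring] at h2
    have := add_mem h1 h2
    convert! this using 1
    ring

theorem FormalMultilinearSeries.apply_eq_zero_of_mem_vanishingSubmodule {h : (Fin d → ℂ) → ℂ} {j : ℕ}
    (hh : h ∈ vanishingSubmodule d j) {p : FormalMultilinearSeries ℂ (Fin d → ℂ) ℂ}
    (hp : HasFPowerSeriesAt h p 0) (i : ℕ) (hi : i < j) (y : Fin d → ℂ) :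
    (p i fun _ => y) = 0 := by
  induction i using Nat.strong_induction_on generalizing y with
  | _ i ih =>
    refine Asymptotics.IsBigO.continuousMultilinearMap_apply_eq_zero ?_ y
    have h1 := hp.isBigO_sub_partialSum_pow (i + 1)
    have h2 := hh.2.trans (isBigO_pow_norm_of_le (d := d) (Nat.succ_le_of_lt hi))
    have h3 := h2.sub h1
    refine h3.congr_left fun x => ?_
    rw [zero_add, sub_sub_cancel, FormalMultilinearSeries.partialSum, Finset.sum_range_succ,
      Finset.sum_eq_zero, zero_add]
    intro k hk
    rw [Finset.mem_range] at hk
    exact ih k hk (hk.trans hi) x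

theorem mem_vanishingSubmodule_one {h : (Fin d → ℂ) → ℂ} (hh : AnalyticAt ℂ h 0) (h0 : h 0 = 0) :
    h ∈ vanishingSubmodule d 1 := by
  refine ⟨hh, ?_⟩
  have := hh.differentiableAt.isBigO_sub
  simp only [h0, sub_zero] at this
  simpa using this.norm_right

theorem mem_vanishingSubmodule_two {h : (Fin d → ℂ) → ℂ} (hh : AnalyticAt ℂ h 0) (h0 : h 0 = 0)
    (h1 : fderiv ℂ h 0 = 0) : h ∈ vanishingSubmodule d 2 := by
  refine ⟨hh, ?_⟩
  obtain ⟨p, hp⟩ := hh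
  refine (hp.isBigO_sub_partialSum_pow 2).congr_left fun x => ?_
  have h2 : p 1 (fun _ => x) = 0 := by
    have := hp.fderiv_eq
    rw [h1] at this
    have h3 := congrArg (fun L => L x) this
    rw [show (fun _ : Fin 1 => x) = ![x] by ext i; simp]
    simpa [continuousMultilinearCurryFin1_apply] using h3.symm
  have h3 : p 0 (fun _ => x) = 0 := by rw [← h0, ← hp.coeff_zero (fun _ => x)]
  simp [FormalMultilinearSeries.partialSum, Finset.sum_range_succ, h2, h3]

theorem fderiv_eq_zero_of_mem_vanishingSubmodule {h : (Fin d → ℂ) → ℂ}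
    (hh : h ∈ vanishingSubmodule d 2) : h 0 = 0 ∧ HasFDerivAt h (0 : (Fin d → ℂ) →L[ℂ] ℂ) 0 := by
  have h0 : h 0 = 0 := by
    have := hh.2.eq_zero_imp.self_of_nhds
    exact this (by simp)
  refine ⟨h0, ?_⟩
  have h1 : h =o[𝓝 0] fun x : Fin d → ℂ => x :=
    hh.2.trans_isLittleO (Asymptotics.isLittleO_norm_pow_id one_lt_two)
  rw [hasFDerivAt_iff_isLittleO]
  simpa [h0] using h1

/-- The degree `j` Taylor term is expanded multilinearly in the basis. Monomials are indexed by maps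
`σ`, with repetitions, so no symmetrization is needed. -/
theorem exists_sum_products {j : ℕ} (b : Module.Basis (Fin d) ℂ (Fin d → ℂ)) {h : (Fin d → ℂ) → ℂ}
    (hh : h ∈ vanishingSubmodule d j) :
    ∃ a : (Fin j → Fin d) → ℂ,
      h - ∑ σ, a σ • ∏ t, ⇑(b.coord (σ t)) ∈ vanishingSubmodule d (j + 1) := by
  obtain ⟨p, hp⟩ := hh.1
  refine ⟨fun σ => p j fun t => b (σ t), hh.1.sub ?_, ?_⟩
  · refine Finset.analyticAt_sum _ fun σ _ => analyticAt_const.smul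
      (Finset.analyticAt_prod _ fun t _ => ?_)
    exact (LinearMap.toContinuousLinearMap (b.coord (σ t))).analyticAt 0
  · refine (hp.isBigO_sub_partialSum_pow (j + 1)).congr_left fun x => ?_
    rw [zero_add, FormalMultilinearSeries.partialSum, Finset.sum_range_succ, Finset.sum_eq_zero,
      zero_add]
    swap
    · intro i hi
      exact FormalMultilinearSeries.apply_eq_zero_of_mem_vanishingSubmodule hh hp i
        (Finset.mem_range.mp hi) x
    rw [Pi.sub_apply]
    congr 1
    conv_lhs => rw [← b.sum_repr x]
    have h1 := (p j).toMultilinearMap.map_sum (fun (_ : Fin j) (i : Fin d) => b.repr x i • b i)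
    simp only [ContinuousMultilinearMap.coe_coe] at h1
    rw [h1, Finset.sum_apply]
    refine Finset.sum_congr rfl fun σ _ => ?_
    rw [(p j).map_smul_univ]
    simp [mul_comm]

/-- The origin has a neighbourhood basis of forward invariant sets contracted at rate `ρ`. -/
structure IsUniformlyContracting (f : (Fin d → ℂ) → (Fin d → ℂ)) (ρ C : ℝ) : Prop where
  pos : 0 < ρ
  lt_one : ρ < 1
  const_pos : 0 < C
  exists_nhds : ∀ U ∈ 𝓝 (0 : Fin d → ℂ), ∃ V ⊆ U, IsOpen V ∧ (0 : Fin d → ℂ) ∈ V ∧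
      Set.MapsTo f V V ∧ ∀ x ∈ V, ∀ n, ‖f^[n] x‖ ≤ C * ρ ^ n * ‖x‖

theorem AnalyticOnNhd.iterate_of_mapsTo {E : Type*} [NormedAddCommGroup E] [NormedSpace ℂ E]
    {f : E → E} {V : Set E} (hf : AnalyticOnNhd ℂ f V) (hV : Set.MapsTo f V V) (n : ℕ) :
    AnalyticOnNhd ℂ f^[n] V := by
  induction n with
  | zero => exact analyticOnNhd_id
  | succ n ih =>
    rw [Function.iterate_succ]
    exact ih.comp hf hV

/-- The operator `u ↦ u ∘ f - c u`. -/
def coboundary (f : (Fin d → ℂ) → (Fin d → ℂ)) (c : ℂ) :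
    ((Fin d → ℂ) → ℂ) →ₗ[ℂ] ((Fin d → ℂ) → ℂ) :=
  LinearMap.funLeft ℂ ℂ f - c • LinearMap.id

@[simp]
theorem coboundary_apply (f : (Fin d → ℂ) → (Fin d → ℂ)) (c : ℂ) (u : (Fin d → ℂ) → ℂ)
    (x : Fin d → ℂ) : coboundary f c u x = u (f x) - c * u x := rfl

theorem IsUniformlyContracting.exists_coboundary_eq {f : (Fin d → ℂ) → (Fin d → ℂ)} {ρ C : ℝ}
    (hfc : IsUniformlyContracting f ρ C) (hf : AnalyticAt ℂ f 0) {c : ℂ} {N : ℕ}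
    (hN : ρ ^ N < ‖c‖) {e : (Fin d → ℂ) → ℂ} (he : e ∈ vanishingSubmodule d N) :
    ∃ h ∈ vanishingSubmodule d N, ∀ᶠ x in 𝓝 (0 : Fin d → ℂ), coboundary f c h x = e x := by
  have hρ := hfc.pos
  have hCpos := hfc.const_pos
  have hc : 0 < ‖c‖ := (pow_pos hρ N).trans hN
  have hc0 : c ≠ 0 := norm_pos_iff.mp hc
  obtain ⟨K, hK, hKe⟩ := he.2.exists_pos
  obtain ⟨V, hVU, hVo, hV0, hfV, hVn⟩ := hfc.exists_nhds _
    (hKe.bound.and (he.1.eventually_analyticAt.and hf.eventually_analyticAt))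
  set F : ℕ → (Fin d → ℂ) → ℂ := fun n x => -(c⁻¹) ^ (n + 1) * e (f^[n] x) with hF
  set r : ℝ := ρ ^ N / ‖c‖ with hr
  have hr0 : 0 ≤ r := by positivity
  have hr1 : r < 1 := (div_lt_one hc).mpr hN
  have hbound : ∀ n, ∀ x ∈ V, ‖F n x‖ ≤ K * C ^ N * ‖c‖⁻¹ * ‖x‖ ^ N * r ^ n := by
    intro n x hx
    have h1 := (hVU (hfV.iterate n hx)).1
    rw [norm_pow, norm_norm] at h1
    rw [hF]
    simp only [neg_mul, norm_neg, norm_mul, norm_pow, norm_inv]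
    calc _ ≤ ‖c‖⁻¹ ^ (n + 1) * (K * (C * ρ ^ n * ‖x‖) ^ N) := by
          gcongr
          exact h1.trans (by gcongr; exact hVn x hx n)
      _ = _ := by
          rw [hr, div_eq_mul_inv, mul_pow, mul_pow, mul_pow, ← pow_mul, ← pow_mul, mul_comm N n,
            pow_succ]
          ring
  have hgeo := summable_geometric_of_lt_one hr0 hr1
  obtain ⟨δ, hδ, hδV⟩ := Metric.isOpen_iff.mp hVo 0 hV0
  have hsumm : ∀ x ∈ V, Summable fun n => F n x := fun x hx =>
    Summable.of_norm_bounded (hgeo.mul_left _) fun n => hbound n x hx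
  refine ⟨fun x => ∑' n, F n x, ⟨?_, ?_⟩, ?_⟩
  · refine analyticAt_tsum_of_norm_le hδ (M := fun n => K * C ^ N * ‖c‖⁻¹ * δ ^ N * r ^ n)
      (fun n x hx => ?_) (fun n x hx => ?_) (hgeo.mul_left _)
    · have hxV := hδV hx
      refine analyticAt_const.mul (AnalyticAt.comp (f := f^[n]) ?_ ?_)
      · exact (hVU (hfV.iterate n hxV)).2.1
      · exact AnalyticOnNhd.iterate_of_mapsTo (fun y hy => (hVU hy).2.2) hfV n x hxV
    · refine (hbound n x (hδV hx)).trans ?_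
      rw [mem_ball_zero_iff] at hx
      gcongr
  · refine Asymptotics.IsBigO.of_bound (K * C ^ N * ‖c‖⁻¹ * (1 - r)⁻¹) ?_
    filter_upwards [hVo.mem_nhds hV0] with x hx
    refine (tsum_of_norm_bounded ((hasSum_geometric_of_lt_one hr0 hr1).mul_left _)
      fun n => hbound n x hx).trans_eq ?_
    rw [norm_pow, norm_norm]
    ring
  · filter_upwards [hVo.mem_nhds hV0] with x hx
    have h1 : ∀ n, F n (f x) = c * F (n + 1) x := by
      intro n
      rw [hF]
      simp only [Function.iterate_succ_apply]
      rw [pow_succ c⁻¹ (n + 1)]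
      linear_combination (c⁻¹ ^ (n + 1) * e (f^[n] (f x))) * mul_inv_cancel₀ hc0
    rw [coboundary_apply]
    simp only [h1]
    rw [tsum_mul_left, (hsumm x hx).tsum_eq_zero_add]
    have h2 : c * F 0 x = - e x := by
      rw [hF]
      simp only [zero_add, pow_one, Function.iterate_zero, id]
      field_simp
    linear_combination -h2

end Cohomological

/-! ### Triangular semiconjugacies -/

section Triangular

variable {d s : ℕ} {f : (Fin d → ℂ) → (Fin d → ℂ)} {b : Module.Basis (Fin d) ℂ (Fin d → ℂ)}
  {μ : Fin d → ℂ}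

theorem analyticAt_coord (b : Module.Basis (Fin d) ℂ (Fin d → ℂ)) (i : Fin d) (x : Fin d → ℂ) :
    AnalyticAt ℂ (b.coord i) x :=
  (LinearMap.toContinuousLinearMap (b.coord i)).analyticAt x

theorem coord_mem_vanishingSubmodule (b : Module.Basis (Fin d) ℂ (Fin d → ℂ)) (i : Fin d) :
    ⇑(b.coord i) ∈ vanishingSubmodule d 1 :=
  mem_vanishingSubmodule_one (analyticAt_coord b i 0) (map_zero _)

theorem IsHolomorphicGerm.comp_mem_vanishingSubmodule_one (hf : IsHolomorphicGerm f)
    {h : (Fin d → ℂ) → ℂ} (hh : h ∈ vanishingSubmodule d 1) :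
    h ∘ f ∈ vanishingSubmodule d 1 := by
  refine mem_vanishingSubmodule_one (AnalyticAt.comp (by rw [hf.map_zero]; exact hh.1) hf.analyticAt) ?_
  rw [Function.comp_apply, hf.map_zero]
  exact hh.2.eq_zero_imp.self_of_nhds (by simp)

theorem IsHolomorphicGerm.coord_comp_sub (hf : IsHolomorphicGerm f)
    (b : Module.Basis (Fin d) ℂ (Fin d → ℂ)) (i : Fin d) :
    ⇑(b.coord i) ∘ f - ⇑(b.coord i) ∘ differentialAtZero f ∈ vanishingSubmodule d 2 := by
  set L := LinearMap.toContinuousLinearMap (b.coord i)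
  have h1 : HasFDerivAt (⇑(b.coord i) ∘ f) (L.comp (fderiv ℂ f 0)) 0 :=
    (L.hasFDerivAt (x := f 0)).comp 0 hf.analyticAt.differentiableAt.hasFDerivAt
  have h2 : HasFDerivAt (⇑(b.coord i) ∘ differentialAtZero f) (L.comp (fderiv ℂ f 0)) 0 :=
    (L.comp (fderiv ℂ f 0)).hasFDerivAt
  refine mem_vanishingSubmodule_two ?_ (by simp [hf.map_zero]) ?_
  · exact (AnalyticAt.comp (analyticAt_coord b i _) hf.analyticAt).sub
      ((L.comp (fderiv ℂ f 0)).analyticAt 0)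
  · simpa using (h1.sub h2).fderiv

theorem leafwiseConstant_prod_mem {φ : Fin d → (Fin d → ℂ) → ℂ} {j k : ℕ} {σ : Fin j → Fin d}
    (hσ : ∀ t, (σ t : ℕ) < k) : ∏ t, φ (σ t) ∈ leafwiseConstant φ k := by
  refine Filter.Eventually.of_forall fun z hz => ?_
  simp only [Finset.prod_apply]
  exact Finset.prod_congr rfl fun t _ => hz _ (hσ t)

theorem mem_leafwiseConstant_self {φ : Fin d → (Fin d → ℂ) → ℂ} {k : ℕ} {i : Fin d}
    (hi : (i : ℕ) < k) : φ i ∈ leafwiseConstant φ k :=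
  Filter.Eventually.of_forall fun _ hz => hz i hi

theorem leafwiseConstant_mono {φ : Fin d → (Fin d → ℂ) → ℂ} {k l : ℕ} (hkl : k ≤ l) :
    leafwiseConstant φ k ≤ leafwiseConstant φ l := fun _ hc =>
  hc.mono fun _ h hz => h fun i hi => hz i (hi.trans_le hkl)

theorem leafwiseConstant_congr {φ ψ : Fin d → (Fin d → ℂ) → ℂ} {k : ℕ}
    (h : ∀ i : Fin d, (i : ℕ) < k → φ i = ψ i) : leafwiseConstant φ k = leafwiseConstant ψ k := by
  ext c
  refine Filter.eventually_congr (Filter.Eventually.of_forall fun z => ?_)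
  have : (∀ i : Fin d, (i : ℕ) < k → φ i z.1 = φ i z.2) ↔
      ∀ i : Fin d, (i : ℕ) < k → ψ i z.1 = ψ i z.2 :=
    forall₂_congr fun i hi => by rw [h i hi]
  rw [this]

/-- In a resonance with at least two factors, removing one factor leaves a product of modulus less
than one, so that factor has modulus strictly larger than `‖μ k‖`. -/
theorem IsAdaptedBasis.lt_of_prod_eq (hb : IsAdaptedBasis (differentialAtZero f) b μ s)
    (hμ : ∀ i, ‖μ i‖ < 1) {k : Fin d} (hk : μ k ≠ 0) {j : ℕ} (hj : 2 ≤ j) {σ : Fin j → Fin d}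
    (hσ : ∏ t, μ (σ t) = μ k) (t : Fin j) : σ t < k := by
  by_contra hcon
  push Not at hcon
  have h1 := hb.antitone _ _ hcon
  have hne : ∀ t, μ (σ t) ≠ 0 := fun t ht =>
    hk (by rw [← hσ]; exact Finset.prod_eq_zero (Finset.mem_univ t) ht)
  obtain ⟨t', ht'⟩ : ∃ t' : Fin j, t' ≠ t := by
    have : Nontrivial (Fin j) := Fin.nontrivial_iff_two_le.mpr hj
    exact exists_ne t
  have h2 : ∏ i ∈ Finset.univ.erase t, ‖μ (σ i)‖ < 1 := by
    rw [← Finset.mul_prod_erase _ _ (Finset.mem_erase.mpr ⟨ht', Finset.mem_univ t'⟩)]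
    calc _ ≤ ‖μ (σ t')‖ * 1 := by
          gcongr
          exact Finset.prod_le_one (fun i _ => norm_nonneg _) fun i _ => (hμ _).le
      _ < 1 := by rw [mul_one]; exact hμ _
  have h3 : ‖μ k‖ = ‖μ (σ t)‖ * ∏ i ∈ Finset.univ.erase t, ‖μ (σ i)‖ := by
    rw [← hσ, norm_prod, Finset.mul_prod_erase _ (fun i => ‖μ (σ i)‖) (Finset.mem_univ t)]
  have h4 : 0 < ‖μ (σ t)‖ := norm_pos_iff.mpr (hne t)
  nlinarith

/-- Induction on the weight `∑ σ t`: composing a monomial with the triangular linear part multiplies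
it by `∏ μ (σ t)` and adds monomials of smaller weight. If that product differs from `μ k`, divide
by the difference; monomials involving a zero eigenvalue always fall here, as `μ k ≠ 0`. A resonant
monomial involves only indices below `k`, and replacing its coordinates by the `φ i` costs one
order. -/
theorem IsAdaptedBasis.prod_coord_mem (hb : IsAdaptedBasis (differentialAtZero f) b μ s)
    (hf : IsHolomorphicGerm f) (hμ : ∀ i, ‖μ i‖ < 1) {k : Fin d} (hk : μ k ≠ 0)
    {φ : Fin d → (Fin d → ℂ) → ℂ} (hφ : ∀ i < k, φ i - ⇑(b.coord i) ∈ vanishingSubmodule d 2)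
    {j : ℕ} (hj : 2 ≤ j) (m : ℕ) (σ : Fin j → Fin d) (hm : ∑ t, (σ t : ℕ) = m) :
    ∏ t, ⇑(b.coord (σ t)) ∈ (vanishingSubmodule d j).map (coboundary f (μ k)) ⊔
      leafwiseConstant φ k ⊔ vanishingSubmodule d (j + 1) := by
  induction m using Nat.strong_induction_on generalizing σ with
  | _ m ih =>
  set W := (vanishingSubmodule d j).map (coboundary f (μ k)) ⊔
      leafwiseConstant φ k ⊔ vanishingSubmodule d (j + 1) with hW
  have hord : ∀ σ : Fin j → Fin d, ∏ t, ⇑(b.coord (σ t)) ∈ vanishingSubmodule d j := fun σ => by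
    have := prod_mem_vanishingSubmodule Finset.univ (a := fun t => ⇑(b.coord (σ t)))
      fun t _ => coord_mem_vanishingSubmodule b (σ t)
    simpa using this
  by_cases hres : ∏ t, μ (σ t) = μ k
  · have hlt := hb.lt_of_prod_eq hμ hk hj hres
    have h1 : ∏ t, φ (σ t) ∈ W :=
      Submodule.mem_sup_left (Submodule.mem_sup_right (leafwiseConstant_prod_mem hlt))
    have h2 : ∏ t, φ (σ t) - ∏ t, ⇑(b.coord (σ t)) ∈ vanishingSubmodule d (j + 1) := by
      have := prod_sub_prod_mem_vanishingSubmodule Finset.univ (a := fun t => φ (σ t))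
        (b := fun t => ⇑(b.coord (σ t)))
        (fun t _ => by
          have := add_mem (vanishingSubmodule_anti one_le_two (hφ _ (hlt t)))
            (coord_mem_vanishingSubmodule b (σ t))
          rwa [sub_add_cancel] at this)
        (fun t _ => coord_mem_vanishingSubmodule b (σ t)) (fun t _ => hφ _ (hlt t))
      simpa using this
    have h3 := sub_mem h1 (Submodule.mem_sup_right h2 : _ ∈ W)
    rwa [sub_sub_cancel] at h3
  · set P : (Fin d → ℂ) → ℂ := ∏ t, ⇑(b.coord (σ t)) with hP
    have h1 : coboundary f (μ k) P ∈ W :=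
      Submodule.mem_sup_left (Submodule.mem_sup_left (Submodule.mem_map_of_mem (hord σ)))
    have h2 : (∏ t, (⇑(b.coord (σ t)) ∘ f)) -
        ∏ t, (⇑(b.coord (σ t)) ∘ differentialAtZero f) ∈ vanishingSubmodule d (j + 1) := by
      have hT : ∀ t, ⇑(b.coord (σ t)) ∘ f ∈ vanishingSubmodule d 1 := fun t =>
        hf.comp_mem_vanishingSubmodule_one (coord_mem_vanishingSubmodule b _)
      have := prod_sub_prod_mem_vanishingSubmodule Finset.univ
        (a := fun t => ⇑(b.coord (σ t)) ∘ f)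
        (b := fun t => ⇑(b.coord (σ t)) ∘ differentialAtZero f)
        (fun t _ => hT t)
        (fun t _ => by
          have := sub_mem (hT t) (vanishingSubmodule_anti one_le_two (hf.coord_comp_sub b (σ t)))
          rwa [sub_sub_cancel] at this)
        (fun t _ => hf.coord_comp_sub b (σ t))
      simpa using this
    set A : Fin d → Fin d → ℂ := fun i i' =>
      if i' ≤ i then b.coord i (differentialAtZero f (b i')) else 0 with hA
    have hAd : ∀ i, A i i = μ i := fun i => by
      rw [hA]
      simp only [le_refl, if_true]
      rw [hb.coord_of_le le_rfl, if_pos rfl]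
    have hcoord : ∀ i x, b.coord i (differentialAtZero f x) = ∑ i', A i i' * b.coord i' x := by
      intro i x
      rw [hb.coord_apply, ← Finset.add_sum_erase _ _ (Finset.mem_univ i), hAd, Finset.sum_filter]
      congr 1
      rw [← Finset.add_sum_erase _ _ (Finset.mem_univ i), if_neg (lt_irrefl i), zero_add]
      refine Finset.sum_congr rfl fun i' hi' => ?_
      have hne : i' ≠ i := Finset.ne_of_mem_erase hi'
      rw [hA]
      by_cases h : i' < i
      · simp [h, h.le]
      · have h' : ¬ i' ≤ i := fun h' => h (lt_of_le_of_ne h' hne)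
        simp [h, h']
    have h3 : ∏ t, (⇑(b.coord (σ t)) ∘ differentialAtZero f) =
        ∑ τ : Fin j → Fin d, (∏ t, A (σ t) (τ t)) • ∏ t, ⇑(b.coord (τ t)) := by
      funext x
      simp only [Finset.prod_apply, Function.comp_apply, hcoord, Finset.sum_apply, Pi.smul_apply,
        smul_eq_mul]
      rw [Finset.prod_univ_sum, Fintype.piFinset_univ]
      exact Finset.sum_congr rfl fun τ _ => Finset.prod_mul_distrib
    have h4 : ∀ τ ∈ Finset.univ.erase σ, (∏ t, A (σ t) (τ t)) • ∏ t, ⇑(b.coord (τ t)) ∈ W := by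
      intro τ hτ
      by_cases hle : ∀ t, τ t ≤ σ t
      · refine Submodule.smul_mem _ _ (ih (∑ t, (τ t : ℕ)) ?_ τ rfl)
        rw [← hm]
        obtain ⟨t, ht⟩ := Function.ne_iff.mp (Finset.ne_of_mem_erase hτ)
        exact Finset.sum_lt_sum (fun t _ => Fin.le_def.mp (hle t))
          ⟨t, Finset.mem_univ t, lt_of_le_of_ne (Fin.le_def.mp (hle t)) fun h => ht (Fin.ext h)⟩
      · push Not at hle
        obtain ⟨t, ht⟩ := hle
        rw [Finset.prod_eq_zero (Finset.mem_univ t), zero_smul]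
        · exact zero_mem _
        · rw [hA]
          simp [ht]
    have h5 : coboundary f (μ k) P = ((∏ t, (⇑(b.coord (σ t)) ∘ f)) -
        ∏ t, (⇑(b.coord (σ t)) ∘ differentialAtZero f)) + (∏ t, μ (σ t) - μ k) • P +
        ∑ τ ∈ Finset.univ.erase σ, (∏ t, A (σ t) (τ t)) • ∏ t, ⇑(b.coord (τ t)) := by
      have h6 : coboundary f (μ k) P = (∏ t, (⇑(b.coord (σ t)) ∘ f)) - μ k • P := by
        funext x
        simp [hP, Finset.prod_apply]
      rw [h6, h3, ← Finset.add_sum_erase _ _ (Finset.mem_univ σ)]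
      simp only [hAd, ← hP, sub_smul]
      abel
    have h7 : (∏ t, μ (σ t) - μ k) • P ∈ W := by
      have := sub_mem (sub_mem h1 (sum_mem h4)) (Submodule.mem_sup_right h2 : _ ∈ W)
      convert! this using 1
      rw [h5]
      abel
    have h8 := W.smul_mem (∏ t, μ (σ t) - μ k)⁻¹ h7
    rwa [smul_smul, inv_mul_cancel₀ (sub_ne_zero.mpr hres), one_smul] at h8

theorem IsAdaptedBasis.vanishingSubmodule_le (hb : IsAdaptedBasis (differentialAtZero f) b μ s)
    (hf : IsHolomorphicGerm f) (hμ : ∀ i, ‖μ i‖ < 1) {ρ C : ℝ} (hfc : IsUniformlyContracting f ρ C)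
    {k : Fin d} (hk : μ k ≠ 0) {φ : Fin d → (Fin d → ℂ) → ℂ}
    (hφ : ∀ i < k, φ i - ⇑(b.coord i) ∈ vanishingSubmodule d 2) :
    vanishingSubmodule d 2 ≤ (vanishingSubmodule d 2).map (coboundary f (μ k)) ⊔
      leafwiseConstant φ k := by
  set W := (vanishingSubmodule d 2).map (coboundary f (μ k)) ⊔ leafwiseConstant φ k with hW
  have hstep : ∀ j, 2 ≤ j → vanishingSubmodule d j ≤ W ⊔ vanishingSubmodule d (j + 1) := by
    intro j hj h hh
    obtain ⟨a, ha⟩ := exists_sum_products b hh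
    have h1 : ∑ σ, a σ • ∏ t, ⇑(b.coord (σ t)) ∈ W ⊔ vanishingSubmodule d (j + 1) := by
      have hle : (vanishingSubmodule d j).map (coboundary f (μ k)) ⊔ leafwiseConstant φ k ⊔
          vanishingSubmodule d (j + 1) ≤ W ⊔ vanishingSubmodule d (j + 1) :=
        sup_le_sup_right (sup_le_sup_right (Submodule.map_mono (vanishingSubmodule_anti hj)) _) _
      exact sum_mem fun σ _ => Submodule.smul_mem _ _
        (hle (hb.prod_coord_mem hf hμ hk hφ hj _ σ rfl))
    have := add_mem (Submodule.mem_sup_right ha : _ ∈ W ⊔ vanishingSubmodule d (j + 1)) h1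
    rwa [sub_add_cancel] at this
  have hall : ∀ n, vanishingSubmodule d 2 ≤ W ⊔ vanishingSubmodule d (2 + n) := by
    intro n
    induction n with
    | zero => exact le_sup_right
    | succ n ih =>
      refine ih.trans (sup_le le_sup_left ?_)
      exact hstep (2 + n) (by omega)
  -- Only finitely many orders need the monomial reduction: beyond this `N` the equation is solved
  -- exactly near `0`.
  obtain ⟨N, hN⟩ := exists_pow_lt_of_lt_one (norm_pos_iff.mpr hk) hfc.lt_one
  have hN2 : ρ ^ (2 + N) < ‖μ k‖ :=
    (pow_le_pow_of_le_one hfc.pos.le hfc.lt_one.le (by omega)).trans_lt hN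
  refine (hall N).trans (sup_le le_rfl fun e he => ?_)
  obtain ⟨h, hh, hhe⟩ := hfc.exists_coboundary_eq hf.analyticAt hN2 he
  have h1 : e - coboundary f (μ k) h ∈ leafwiseConstant φ k :=
    mem_leafwiseConstant_of_eventually_zero (hhe.mono fun x hx => by
      rw [Pi.sub_apply, hx, sub_self])
  have h2 := add_mem (Submodule.mem_sup_right h1 : _ ∈ W) (Submodule.mem_sup_left
    (Submodule.mem_map_of_mem (vanishingSubmodule_anti (by omega) hh)) : coboundary f (μ k) h ∈ W)
  rwa [sub_add_cancel] at h2

/-- The linear coupling of the `k`-th coordinate to earlier ones is written with the `φ i`, hence is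
leafwise constant; the error has order two and is split into a coboundary, subtracted from the
coordinate, and a leafwise constant term. -/
theorem IsAdaptedBasis.exists_next (hb : IsAdaptedBasis (differentialAtZero f) b μ s)
    (hf : IsHolomorphicGerm f) (hμ : ∀ i, ‖μ i‖ < 1) {ρ C : ℝ} (hfc : IsUniformlyContracting f ρ C)
    {k : Fin d} (hk : μ k ≠ 0) {φ : Fin d → (Fin d → ℂ) → ℂ}
    (hφ : ∀ i < k, φ i - ⇑(b.coord i) ∈ vanishingSubmodule d 2) :
    ∃ ψ, ψ - ⇑(b.coord k) ∈ vanishingSubmodule d 2 ∧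
      coboundary f (μ k) ψ ∈ leafwiseConstant φ k := by
  set S : (Fin d → ℂ) → ℂ :=
    ∑ i ∈ Finset.univ.filter (· < k), b.coord k (differentialAtZero f (b i)) • φ i with hS
  have hSl : S ∈ leafwiseConstant φ k := sum_mem fun i hi =>
    Submodule.smul_mem _ _ (mem_leafwiseConstant_self (Fin.lt_def.mp (Finset.mem_filter.mp hi).2))
  have hh : coboundary f (μ k) ⇑(b.coord k) - S ∈ vanishingSubmodule d 2 := by
    have h1 := sub_mem (hf.coord_comp_sub b k) (sum_mem (t := Finset.univ.filter (· < k))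
      fun i hi => Submodule.smul_mem (vanishingSubmodule d 2)
        (b.coord k (differentialAtZero f (b i))) (hφ i (Finset.mem_filter.mp hi).2))
    convert! h1 using 1
    funext x
    simp only [hS, Pi.sub_apply, coboundary_apply, Function.comp_apply, Finset.sum_apply,
      Pi.smul_apply, smul_eq_mul, hb.coord_apply k x, mul_sub, Finset.sum_sub_distrib]
    ring
  obtain ⟨_, ⟨u, hu, rfl⟩, c, hc, huc⟩ := Submodule.mem_sup.mp
    (hb.vanishingSubmodule_le hf hμ hfc hk hφ hh)
  refine ⟨⇑(b.coord k) - u, ?_, ?_⟩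
  · rw [sub_sub_cancel_left]
    exact neg_mem hu
  · rw [map_sub]
    have := add_mem hc hSl
    convert! this using 1
    rw [eq_sub_iff_add_eq] at huc
    rw [← huc]
    abel

theorem IsAdaptedBasis.exists_triangular (hb : IsAdaptedBasis (differentialAtZero f) b μ s)
    (hf : IsHolomorphicGerm f) (hμ : ∀ i, ‖μ i‖ < 1) {ρ C : ℝ}
    (hfc : IsUniformlyContracting f ρ C) :
    ∃ φ : Fin d → (Fin d → ℂ) → ℂ, ∀ i : Fin d, (i : ℕ) < s →
      φ i - ⇑(b.coord i) ∈ vanishingSubmodule d 2 ∧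
      coboundary f (μ i) (φ i) ∈ leafwiseConstant φ i := by
  suffices ∀ k ≤ s, ∃ φ : Fin d → (Fin d → ℂ) → ℂ, ∀ i : Fin d, (i : ℕ) < k →
      φ i - ⇑(b.coord i) ∈ vanishingSubmodule d 2 ∧
      coboundary f (μ i) (φ i) ∈ leafwiseConstant φ i from this s le_rfl
  intro k hk
  induction k with
  | zero => exact ⟨0, fun i hi => absurd hi (Nat.not_lt_zero _)⟩
  | succ k ih =>
    obtain ⟨φ, hφ⟩ := ih (by omega)
    by_cases hkd : k < d
    swap
    · exact ⟨φ, fun i hi => hφ i (by omega)⟩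
    obtain ⟨ψ, hψ, hψc⟩ := hb.exists_next hf hμ hfc (k := ⟨k, hkd⟩) ((hb.ne_zero_iff _).mpr hk)
      (φ := φ) fun i hi => (hφ i (Fin.lt_def.mp hi)).1
    refine ⟨Function.update φ ⟨k, hkd⟩ ψ, fun i hi => ?_⟩
    -- Only indices below `i ≤ k` enter here, so the new function does not disturb earlier
    -- relations.
    have hcongr : leafwiseConstant (Function.update φ ⟨k, hkd⟩ ψ) i = leafwiseConstant φ i :=
      leafwiseConstant_congr fun i' hi' => Function.update_of_ne
        (fun h => by rw [h] at hi'; simp at hi'; omega) _ _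
    rw [hcongr]
    rcases Nat.lt_succ_iff_lt_or_eq.mp hi with h | h
    · rw [Function.update_of_ne fun h' => by rw [h'] at h; simp at h]
      exact hφ i h
    · have : i = ⟨k, hkd⟩ := Fin.ext h
      subst this
      rw [Function.update_self]
      exact ⟨hψ, hψc⟩

end Triangular

/-! ### Superexponential contraction along the fibres -/

section Fibres

variable {d s : ℕ} {f : (Fin d → ℂ) → (Fin d → ℂ)} {φ : Fin d → (Fin d → ℂ) → ℂ}

/-- `x` and `y` lie on the same fibre of `(φ i)`, `i < s`. -/
def SameFibre (φ : Fin d → (Fin d → ℂ) → ℂ) (s : ℕ) (x y : Fin d → ℂ) : Prop :=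
  ∀ i : Fin d, (i : ℕ) < s → φ i x = φ i y

/-- The fibres of `(φ i)`, `i < s`, are preserved by `f`, contracted faster than at any given rate,
and admit a holomorphic retraction onto a transversal. -/
structure IsContractedFibration (f : (Fin d → ℂ) → (Fin d → ℂ)) (φ : Fin d → (Fin d → ℂ) → ℂ)
    (s : ℕ) : Prop where
  preserved : ∀ᶠ z : (Fin d → ℂ) × (Fin d → ℂ) in 𝓝 0,
    SameFibre φ s z.1 z.2 → SameFibre φ s (f z.1) (f z.2)
  contracted : ∀ ε > 0, ∀ᶠ z : (Fin d → ℂ) × (Fin d → ℂ) in 𝓝 0,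
    SameFibre φ s z.1 z.2 → ‖f z.1 - f z.2‖ ≤ ε * ‖z.1 - z.2‖
  exists_retraction : ∃ π : (Fin d → ℂ) → (Fin d → ℂ), AnalyticAt ℂ π 0 ∧ π 0 = 0 ∧
    (∀ x y, SameFibre φ s x y → π x = π y) ∧
    ∀ᶠ x in 𝓝 (0 : Fin d → ℂ), SameFibre φ s x (π x)

theorem exists_nhds_of_eventually {p : (Fin d → ℂ) × (Fin d → ℂ) → Prop}
    (h : ∀ᶠ z in 𝓝 (0 : (Fin d → ℂ) × (Fin d → ℂ)), p z) :
    ∃ U ∈ 𝓝 (0 : Fin d → ℂ), ∀ x ∈ U, ∀ y ∈ U, p (x, y) := by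
  rw [← Prod.mk_zero_zero, nhds_prod_eq] at h
  exact (eventually_prod_self_iff (r := fun x y => p (x, y))).mp h

theorem eventually_comp_of_mem_leafwiseConstant {k : ℕ} {μ : Fin d → ℂ}
    (hφ : ∀ i : Fin d, (i : ℕ) < k → coboundary f (μ i) (φ i) ∈ leafwiseConstant φ i) :
    ∀ᶠ z : (Fin d → ℂ) × (Fin d → ℂ) in 𝓝 0,
      SameFibre φ k z.1 z.2 → SameFibre φ k (f z.1) (f z.2) := by
  have h : ∀ i : Fin d, ∀ᶠ z : (Fin d → ℂ) × (Fin d → ℂ) in 𝓝 0,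
      (i : ℕ) < k → SameFibre φ k z.1 z.2 → φ i (f z.1) = φ i (f z.2) := by
    intro i
    by_cases hi : (i : ℕ) < k
    · have h1 := leafwiseConstant_mono hi.le (hφ i hi)
      filter_upwards [h1] with z hz _ hs
      have h2 := hz hs
      rw [coboundary_apply, coboundary_apply, hs i hi] at h2
      linear_combination h2
    · simp [hi]
  filter_upwards [Filter.eventually_all.mpr h] with z hz hs i hi
  exact hz i hi hs

/-- For two points of one fibre, the first `s` coordinates of their difference are `o(‖z.1 - z.2‖)`,
because `φ i` minus the coordinate has zero strict derivative at `0`. The other coordinates are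
killed by `df₀`, since its nilpotent part vanishes. -/
theorem IsAdaptedBasis.eventually_norm_sub_le {b : Module.Basis (Fin d) ℂ (Fin d → ℂ)}
    {μ : Fin d → ℂ} (hb : IsAdaptedBasis (differentialAtZero f) b μ s) (hf : IsHolomorphicGerm f)
    (hnil : NilpotentPartVanishes f)
    (hφ : ∀ i : Fin d, (i : ℕ) < s → φ i - ⇑(b.coord i) ∈ vanishingSubmodule d 2) {ε : ℝ}
    (hε : 0 < ε) : ∀ᶠ z : (Fin d → ℂ) × (Fin d → ℂ) in 𝓝 0,
      SameFibre φ s z.1 z.2 → ‖f z.1 - f z.2‖ ≤ ε * ‖z.1 - z.2‖ := by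
  set T := differentialAtZero f with hT
  set D : ℝ := ∑ i, ‖T (b i)‖ with hD
  have hD0 : 0 ≤ D := Finset.sum_nonneg fun i _ => norm_nonneg _
  set η : ℝ := ε / (1 + D) with hη
  have hη0 : 0 < η := by positivity
  have h1 := hf.analyticAt.hasStrictFDerivAt.isLittleO.def hη0
  have h2 : ∀ i : Fin d, ∀ᶠ z : (Fin d → ℂ) × (Fin d → ℂ) in 𝓝 0, (i : ℕ) < s →
      ‖(φ i - ⇑(b.coord i)) z.1 - (φ i - ⇑(b.coord i)) z.2‖ ≤ η * ‖z.1 - z.2‖ := by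
    intro i
    by_cases hi : (i : ℕ) < s
    · have h3 := (hφ i hi).1.hasStrictFDerivAt
      rw [(fderiv_eq_zero_of_mem_vanishingSubmodule (hφ i hi)).2.fderiv] at h3
      have h4 := h3.isLittleO.def hη0
      rw [Prod.mk_zero_zero] at h4
      filter_upwards [h4] with z hz _
      simpa using hz
    · simp [hi]
  rw [Prod.mk_zero_zero] at h1
  filter_upwards [h1, Filter.eventually_all.mpr h2] with z hz hz' hs
  have h3 : ∀ i, ‖b.repr (z.1 - z.2) i • T (b i)‖ ≤ η * ‖z.1 - z.2‖ * ‖T (b i)‖ := by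
    intro i
    by_cases hi : (i : ℕ) < s
    · rw [norm_smul]
      gcongr
      refine le_of_eq_of_le ?_ (hz' i hi)
      rw [← norm_neg]
      congr 1
      simp only [Pi.sub_apply, hs i hi, Module.Basis.coord_apply, map_sub, Finsupp.sub_apply]
      ring
    · rw [hb.apply_eq_zero hnil (by omega), smul_zero, norm_zero, mul_zero]
  have h4 : ‖T (z.1 - z.2)‖ ≤ η * ‖z.1 - z.2‖ * D := by
    conv_lhs => rw [← b.sum_repr (z.1 - z.2)]
    rw [map_sum, hD, Finset.mul_sum]
    refine norm_sum_le_of_le _ fun i _ => ?_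
    rw [map_smul]
    exact h3 i
  calc ‖f z.1 - f z.2‖ ≤ ‖f z.1 - f z.2 - fderiv ℂ f 0 (z.1 - z.2)‖ + ‖T (z.1 - z.2)‖ := by
        refine le_of_eq_of_le ?_ (norm_add_le _ _)
        congr 1
        change _ = f z.1 - f z.2 - T (z.1 - z.2) + T (z.1 - z.2)
        abel
    _ ≤ η * ‖z.1 - z.2‖ + η * ‖z.1 - z.2‖ * D := add_le_add hz h4
    _ = ε * ‖z.1 - z.2‖ := by
        rw [hη]
        field_simp

theorem hasFDerivAt_of_sub_coord_mem {b : Module.Basis (Fin d) ℂ (Fin d → ℂ)} {i : Fin d}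
    {h : (Fin d → ℂ) → ℂ} (hh : h - ⇑(b.coord i) ∈ vanishingSubmodule d 2) :
    AnalyticAt ℂ h 0 ∧ h 0 = 0 ∧
      HasFDerivAt h (LinearMap.toContinuousLinearMap (b.coord i)) 0 := by
  have h1 := (fderiv_eq_zero_of_mem_vanishingSubmodule hh)
  have h2 := h1.2.add (LinearMap.toContinuousLinearMap (b.coord i)).hasFDerivAt
  have h3 : h = h - ⇑(b.coord i) + ⇑(LinearMap.toContinuousLinearMap (b.coord i)) := by
    funext x
    simp
  refine ⟨?_, ?_, ?_⟩
  · rw [h3]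
    exact hh.1.add (ContinuousLinearMap.analyticAt _ _)
  · simpa using h1.1
  · rw [h3]
    simpa using h2

/-- With `P = (φ i)` and `R` the linear embedding along the first `s` basis vectors, `P ∘ R` is
tangent to the identity; if `θ` is its local inverse, take `π = R ∘ θ ∘ P`. Factoring through `P`
makes `π` constant on fibres without shrinking. -/
theorem exists_retraction {b : Module.Basis (Fin d) ℂ (Fin d → ℂ)}
    (hφ : ∀ i : Fin d, (i : ℕ) < s → φ i - ⇑(b.coord i) ∈ vanishingSubmodule d 2) :
    ∃ π : (Fin d → ℂ) → (Fin d → ℂ), AnalyticAt ℂ π 0 ∧ π 0 = 0 ∧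
      (∀ x y, SameFibre φ s x y → π x = π y) ∧
      ∀ᶠ x in 𝓝 (0 : Fin d → ℂ), SameFibre φ s x (π x) := by
  set ι := {i : Fin d // (i : ℕ) < s}
  set P : (Fin d → ℂ) → (ι → ℂ) := fun x i => φ i x with hP
  set R : (ι → ℂ) →L[ℂ] (Fin d → ℂ) := LinearMap.toContinuousLinearMap
    (Fintype.linearCombination ℂ fun i : ι => b i) with hR
  have hRb : ∀ (i : ι) y, b.coord i (R y) = y i := by
    intro i y
    rw [hR, LinearMap.coe_toContinuousLinearMap', Fintype.linearCombination_apply, map_sum]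
    simp only [map_smul, b.coord_apply, b.repr_self, Finsupp.smul_apply, Finsupp.single_apply, smul_eq_mul,
      mul_ite, mul_one, mul_zero]
    rw [Finset.sum_eq_single i]
    · simp
    · intro j _ hj
      rw [if_neg (fun h => hj (Subtype.ext h))]
    · simp
  have hd : ∀ i : ι, AnalyticAt ℂ (φ i) 0 ∧ φ i 0 = 0 ∧
      HasFDerivAt (φ i) (LinearMap.toContinuousLinearMap (b.coord i)) 0 := fun i =>
    hasFDerivAt_of_sub_coord_mem (hφ i i.2)
  have hPa : AnalyticAt ℂ P 0 := AnalyticAt.pi fun i => (hd i).1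
  have hP0 : P 0 = 0 := funext fun i => (hd i).2.1
  have hθa : AnalyticAt ℂ (fun y => P (R y)) 0 :=
    AnalyticAt.comp (g := P) (f := R) (by rwa [map_zero]) (R.analyticAt 0)
  have hθd : HasFDerivAt (fun y => P (R y))
      ((ContinuousLinearEquiv.refl ℂ (ι → ℂ) : (ι → ℂ) ≃L[ℂ] (ι → ℂ)) : (ι → ℂ) →L[ℂ] (ι → ℂ)) 0 := by
    rw [hasFDerivAt_pi']
    intro i
    have h1 : HasFDerivAt (φ i) (LinearMap.toContinuousLinearMap (b.coord i)) (R 0) := by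
      rw [map_zero]
      exact (hd i).2.2
    have h2 := h1.comp (0 : ι → ℂ) R.hasFDerivAt
    convert! h2 using 1
    ext1 y
    simpa using (hRb i y).symm
  obtain ⟨θ, hθ, hθ0, -, hright⟩ := hθa.exists_local_inverse (by simp [hP0]) _ hθd
  have hθP : AnalyticAt ℂ (fun x => θ (P x)) 0 := AnalyticAt.comp (f := P) (by rwa [hP0]) hPa
  refine ⟨fun x => R (θ (P x)), AnalyticAt.comp (f := fun x => θ (P x)) (R.analyticAt _) hθP,
    by simp [hP0, hθ0], fun x y hxy => ?_, ?_⟩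
  · have : P x = P y := funext fun i => hxy i i.2
    simp only [this]
  · have ht : Tendsto P (𝓝 0) (𝓝 0) := by simpa [hP0] using hPa.continuousAt.tendsto
    filter_upwards [ht.eventually hright] with x hx i hi
    exact (congrFun hx ⟨i, hi⟩).symm

theorem IsContractedFibration.exists_nhds {ρ C : ℝ} (hF : IsContractedFibration f φ s)
    (hfc : IsUniformlyContracting f ρ C) {ε : ℝ} (hε : 0 < ε) {U : Set (Fin d → ℂ)}
    (hU : U ∈ 𝓝 0) : ∃ V ⊆ U, IsOpen V ∧ (0 : Fin d → ℂ) ∈ V ∧ Set.MapsTo f V V ∧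
      ∀ x ∈ V, ∀ y ∈ V, SameFibre φ s x y → ∀ n, SameFibre φ s (f^[n] x) (f^[n] y) ∧
        ‖f^[n] x - f^[n] y‖ ≤ ε ^ n * ‖x - y‖ := by
  obtain ⟨U', hU', hUU⟩ := exists_nhds_of_eventually (hF.preserved.and (hF.contracted ε hε))
  obtain ⟨V, hV, hVo, hV0, hfV, -⟩ := hfc.exists_nhds _ (Filter.inter_mem hU hU')
  refine ⟨V, fun x hx => (hV hx).1, hVo, hV0, hfV, fun x hx y hy hxy n => ?_⟩
  induction n with
  | zero => simpa using hxy
  | succ n ih =>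
    have h := hUU _ (hV (hfV.iterate n hx)).2 _ (hV (hfV.iterate n hy)).2
    rw [Function.iterate_succ_apply', Function.iterate_succ_apply', pow_succ']
    refine ⟨h.1 ih.1, (h.2 ih.1).trans ?_⟩
    rw [mul_assoc]
    gcongr
    exact ih.2

theorem AnalyticAt.exists_lipschitz {E F : Type*} [NormedAddCommGroup E] [NormedSpace ℂ E]
    [NormedAddCommGroup F] [NormedSpace ℂ F] {h : E → F} (hh : AnalyticAt ℂ h 0) :
    ∃ K : ℝ, 0 ≤ K ∧ ∃ U ∈ 𝓝 (0 : E), ∀ x ∈ U, ∀ y ∈ U, ‖h x - h y‖ ≤ K * ‖x - y‖ := by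
  obtain ⟨K, U, hU, hK⟩ := hh.hasStrictFDerivAt.exists_lipschitzOnWith
  exact ⟨K, K.2, U, hU, fun x hx y hy => by simpa [dist_eq_norm] using hK.dist_le_mul x hx y hy⟩

/-- Along a fibre the differences of `h` shrink under `f` by at most the factor `η`, whereas points
approach each other at rate `η / 2`. By the Lipschitz bound the initial difference is `O(2 ^ (-n))`
for every `n`, hence zero. -/
theorem IsContractedFibration.mem_leafwiseConstant {ρ C : ℝ} (hF : IsContractedFibration f φ s)
    (hfc : IsUniformlyContracting f ρ C) {h m : (Fin d → ℂ) → ℂ} (hh : AnalyticAt ℂ h 0)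
    (hm : ContinuousAt m 0) (hm0 : m 0 ≠ 0) (hmφ : m ∈ leafwiseConstant φ s)
    (heq : ∀ᶠ x in 𝓝 (0 : Fin d → ℂ), h (f x) = m x * h x) : h ∈ leafwiseConstant φ s := by
  set η : ℝ := ‖m 0‖ / 2 with hη
  have hη0 : 0 < η := half_pos (norm_pos_iff.mpr hm0)
  have hev : ∀ᶠ x in 𝓝 (0 : Fin d → ℂ), η < ‖m x‖ :=
    hm.norm.eventually (lt_mem_nhds (half_lt_self (norm_pos_iff.mpr hm0)))
  obtain ⟨K, hK, U₁, hU₁, hlip⟩ := hh.exists_lipschitz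
  obtain ⟨U₂, hU₂, hmc⟩ := exists_nhds_of_eventually hmφ
  obtain ⟨V, hV, hVo, hV0, hfV, hVn⟩ := hF.exists_nhds hfc (half_pos hη0)
    (Filter.inter_mem (Filter.inter_mem hU₁ hU₂) (hev.and heq))
  change ∀ᶠ z : (Fin d → ℂ) × (Fin d → ℂ) in 𝓝 0, _
  filter_upwards [eventually_fst_snd (hVo.mem_nhds hV0)] with ⟨x, y⟩ ⟨hx, hy⟩ hxy
  have hstep : ∀ x ∈ V, ∀ y ∈ V, SameFibre φ s x y →
      η * ‖h x - h y‖ ≤ ‖h (f x) - h (f y)‖ := by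
    intro x hx y hy hxy
    rw [(hV hx).2.2, (hV hy).2.2, hmc x (hV hx).1.2 y (hV hy).1.2 hxy, ← mul_sub, norm_mul]
    gcongr
    exact (hV hy).2.1.le
  have hall : ∀ n, η ^ n * ‖h x - h y‖ ≤ ‖h (f^[n] x) - h (f^[n] y)‖ := by
    intro n
    induction n with
    | zero => simp
    | succ n ih =>
      rw [Function.iterate_succ_apply', Function.iterate_succ_apply', pow_succ', mul_assoc]
      exact (mul_le_mul_of_nonneg_left ih hη0.le).trans
        (hstep _ (hfV.iterate n hx) _ (hfV.iterate n hy) (hVn x hx y hy hxy n).1)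
  have hle : ∀ n : ℕ, ‖h x - h y‖ ≤ K * ‖x - y‖ * (1 / 2) ^ n := by
    intro n
    have h1 := (hall n).trans ((hlip _ (hV (hfV.iterate n hx)).1.1 _
      (hV (hfV.iterate n hy)).1.1).trans
        (mul_le_mul_of_nonneg_left (hVn x hx y hy hxy n).2 hK))
    rw [← mul_le_mul_iff_right₀ (pow_pos hη0 n)]
    refine h1.trans_eq ?_
    rw [div_eq_mul_one_div η 2, mul_pow]
    ring
  have hlim : Tendsto (fun n : ℕ => K * ‖x - y‖ * (1 / 2 : ℝ) ^ n) atTop (𝓝 0) := by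
    simpa using (tendsto_pow_atTop_nhds_zero_of_lt_one (r := (1 / 2 : ℝ)) (by norm_num)
      (by norm_num)).const_mul (K * ‖x - y‖)
  have := ge_of_tendsto' hlim hle
  exact sub_eq_zero.mp (norm_le_zero_iff.mp this)

/-- The naive solution `∑ M⁻⁽ⁿ⁺¹⁾ β(fⁿ x)` need not converge, as `M⁻¹` may be expanding. Subtracting
the same series at `π x`, in the same fibre, gives convergence; since `π` is constant on fibres,
this subtraction cancels in differences along a fibre, which is all the conclusion tests. -/
theorem IsContractedFibration.exists_cohomological {ρ C : ℝ} (hF : IsContractedFibration f φ s)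
    (hfc : IsUniformlyContracting f ρ C) (hf : AnalyticAt ℂ f 0) (hf0 : f 0 = 0)
    {G : Type*} [NormedAddCommGroup G] [NormedSpace ℂ G] [CompleteSpace G] (M : G ≃L[ℂ] G)
    {β : (Fin d → ℂ) → G} (hβ : AnalyticAt ℂ β 0) :
    ∃ g : (Fin d → ℂ) → G, AnalyticAt ℂ g 0 ∧
      ∀ᶠ z : (Fin d → ℂ) × (Fin d → ℂ) in 𝓝 0, SameFibre φ s z.1 z.2 →
        β z.1 + g (f z.1) - M (g z.1) = β z.2 + g (f z.2) - M (g z.2) := by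
  obtain ⟨π, hπ, hπ0, hπc, hπφ⟩ := hF.exists_retraction
  set N : G →L[ℂ] G := M.symm.toContinuousLinearMap with hN
  -- The contraction rate is chosen so that `‖N‖ * ε ≤ 1 / 2`.
  set ε : ℝ := 1 / (2 * (‖N‖ + 1)) with hε
  have hNε : ‖N‖ * ε ≤ 1 / 2 := by
    rw [hε, mul_one_div, div_le_div_iff₀ (by positivity) two_pos]
    linarith
  obtain ⟨K, hK, U₁, hU₁, hlip⟩ := hβ.exists_lipschitz
  obtain ⟨V, hV, hVo, hV0, hfV, hVn⟩ := hF.exists_nhds hfc (ε := ε) (by positivity)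
    (Filter.inter_mem (Filter.inter_mem hU₁ (Metric.ball_mem_nhds 0 one_pos))
      (hβ.eventually_analyticAt.and hf.eventually_analyticAt))
  have hπt : Tendsto π (𝓝 0) (𝓝 0) := by simpa [hπ0] using hπ.continuousAt.tendsto
  have hft : Tendsto f (𝓝 0) (𝓝 0) := by simpa [hf0] using hf.continuousAt.tendsto
  have hW : ∀ᶠ x in 𝓝 (0 : Fin d → ℂ), x ∈ V ∧ π x ∈ V ∧ SameFibre φ s x (π x) ∧
      AnalyticAt ℂ π x := by
    filter_upwards [hVo.mem_nhds hV0, hπt.eventually (hVo.mem_nhds hV0), hπφ,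
      hπ.eventually_analyticAt] with x h1 h2 h3 h4 using ⟨h1, h2, h3, h4⟩
  obtain ⟨δ, hδ, hδW⟩ := Metric.eventually_nhds_iff_ball.mp hW
  set D : ℕ → (Fin d → ℂ) → (Fin d → ℂ) → G := fun n x y =>
    (N ^ (n + 1)) (β (f^[n] x) - β (f^[n] y)) with hD
  have hbound : ∀ n, ∀ x ∈ V, ∀ y ∈ V, SameFibre φ s x y →
      ‖D n x y‖ ≤ 2 * ‖N‖ * K * (1 / 2) ^ n := by
    intro n x hx y hy hxy
    have h1 := hlip _ (hV (hfV.iterate n hx)).1.1 _ (hV (hfV.iterate n hy)).1.1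
    have h2 := (hVn x hx y hy hxy n).2
    have h3 : ‖x - y‖ ≤ 2 := by
      have hx1 := (hV hx).1.2
      have hy1 := (hV hy).1.2
      rw [mem_ball_zero_iff] at hx1 hy1
      linarith [norm_sub_le x y]
    calc ‖D n x y‖ ≤ ‖N‖ ^ (n + 1) * (K * (ε ^ n * 2)) := by
          refine ((N ^ (n + 1)).le_opNorm _).trans ?_
          gcongr
          · exact norm_pow_le' N n.succ_pos
          · exact h1.trans (by gcongr; exact h2.trans (by gcongr))
      _ = 2 * ‖N‖ * K * (‖N‖ * ε) ^ n := by rw [mul_pow, pow_succ]; ring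
      _ ≤ _ := by gcongr
  have hgeo : Summable fun n : ℕ => 2 * ‖N‖ * K * (1 / 2 : ℝ) ^ n :=
    (summable_geometric_of_lt_one (by norm_num) (by norm_num)).mul_left _
  have hsumm : ∀ x ∈ V, ∀ y ∈ V, SameFibre φ s x y → Summable fun n => D n x y :=
    fun x hx y hy hxy => Summable.of_norm_bounded hgeo fun n => hbound n x hx y hy hxy
  refine ⟨fun x => ∑' n, D n x (π x), ?_, ?_⟩
  · refine analyticAt_tsum_of_norm_le hδ (fun n x hx => ?_)
      (fun n x hx => hbound n x (hδW x hx).1 _ (hδW x hx).2.1 (hδW x hx).2.2.1) hgeo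
    obtain ⟨hxV, hπV, -, hπa⟩ := hδW x hx
    have hit : ∀ y ∈ V, AnalyticAt ℂ (fun y => β (f^[n] y)) y := fun y hy =>
      AnalyticAt.comp (f := f^[n]) (hV (hfV.iterate n hy)).2.1
        (AnalyticOnNhd.iterate_of_mapsTo (fun z hz => (hV hz).2.2) hfV n y hy)
    refine AnalyticAt.comp (g := ⇑(N ^ (n + 1))) ((N ^ (n + 1)).analyticAt _) ?_
    exact (hit x hxV).sub (AnalyticAt.comp (f := π) (hit _ hπV) hπa)
  · have hdiff : ∀ x y, x ∈ V → y ∈ V → π x ∈ V → π y ∈ V → SameFibre φ s x (π x) →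
        SameFibre φ s y (π y) → SameFibre φ s x y →
        (∑' n, D n x (π x)) - ∑' n, D n y (π y) = ∑' n, D n x y := by
      intro x y hx hy hπx hπy hxπ hyπ hxy
      rw [← (hsumm x hx _ hπx hxπ).tsum_sub (hsumm y hy _ hπy hyπ)]
      refine tsum_congr fun n => ?_
      rw [hD]
      simp only
      rw [← map_sub, hπc x y hxy]
      congr 1
      abel
    filter_upwards [eventually_fst_snd hW, eventually_fst_snd (hft.eventually hW), hF.preserved]
      with ⟨x, y⟩ ⟨hx, hy⟩ ⟨hfx, hfy⟩ hpres hxy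
    have hfxy := hpres hxy
    have h1 := hdiff x y hx.1 hy.1 hx.2.1 hy.2.1 hx.2.2.1 hy.2.2.1 hxy
    have h2 := hdiff (f x) (f y) hfx.1 hfy.1 hfx.2.1 hfy.2.1 hfx.2.2.1 hfy.2.2.1 hfxy
    have h3 : ∀ n, D n (f x) (f y) = M (D (n + 1) x y) := by
      intro n
      rw [hD]
      simp only [Function.iterate_succ_apply]
      rw [pow_succ' N (n + 1), mul_apply_eq_comp, hN]
      simp
    have h4 : M (D 0 x y) = β x - β y := by
      rw [hD]
      simp [hN]
    have hs := hsumm x hx.1 y hy.1 hxy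
    have h5 : M (∑' n, D n x y) = β x - β y + ∑' n, D n (f x) (f y) := by
      rw [hs.tsum_eq_zero_add, map_add, h4]
      congr 1
      rw [tsum_congr h3]
      exact M.map_tsum
    rw [← h1, ← h2, map_sub] at h5
    simp only
    rw [← sub_eq_zero] at h5 ⊢
    rw [← neg_eq_zero, ← h5]
    abel

end Fibres

/-! ### Monomial coordinates -/

section Monomial

variable {d q s : ℕ} {f : (Fin d → ℂ) → (Fin d → ℂ)} {φ : Fin d → (Fin d → ℂ) → ℂ}
  {w : Fin q → (Fin d → ℂ) → ℂ}

theorem genCriticalSet_of_apply_mem {x : Fin d → ℂ} (hx : f x ∈ genCriticalSet f) :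
    x ∈ genCriticalSet f := by
  obtain ⟨n, hn⟩ := Set.mem_iUnion.mp hx
  exact Set.mem_iUnion.mpr ⟨n + 1, by simpa [Function.iterate_succ_apply] using hn⟩

theorem IsHolomorphicGerm.tendsto (hf : IsHolomorphicGerm f) : Tendsto f (𝓝 0) (𝓝 0) := by
  simpa [hf.map_zero] using hf.analyticAt.continuousAt.tendsto

theorem IsHolomorphicGerm.analyticAt_comp {E : Type*} [NormedAddCommGroup E] [NormedSpace ℂ E]
    (hf : IsHolomorphicGerm f) {h : (Fin d → ℂ) → E}
    (hh : AnalyticAt ℂ h 0) : AnalyticAt ℂ (fun x => h (f x)) 0 :=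
  AnalyticAt.comp (g := h) (f := f) (by rwa [hf.map_zero]) hf.analyticAt

/-- Zeros of `w k ∘ f` lie in the preimage of the generalized critical set, hence in that set. Were
`w k ∘ f` identically zero, the set would fill a neighbourhood and some `w l` would vanish
identically, against its non-zero differential. -/
theorem IsSNCAtZero.exists_pullback_eq (hw : IsSNCAtZero (genCriticalSet f) w)
    (hf : IsHolomorphicGerm f) (k : Fin q) :
    ∃ u : (Fin d → ℂ) → ℂ, AnalyticAt ℂ u 0 ∧ u 0 ≠ 0 ∧ ∀ᶠ x in 𝓝 (0 : Fin d → ℂ),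
      w k (f x) = u x * ∏ l, w l x ^ internalAction f w l k := by
  have hz : ∀ᶠ x in 𝓝 (0 : Fin d → ℂ), w k (f x) = 0 → ∃ l, w l x = 0 := by
    filter_upwards [hw.mem_iff, hf.tendsto.eventually hw.mem_iff] with x hx hfx h0
    exact hx.mp (genCriticalSet_of_apply_mem (hfx.mpr ⟨k, h0⟩))
  refine hw.exists_factorization (hf.analyticAt_comp (hw.analyticAt k)) (fun hcon => ?_) hz
  obtain ⟨l, -, hl⟩ := AnalyticAt.exists_eventually_eq_zero_of_prod Finset.univ
    (fun l _ => hw.analyticAt l) (by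
      filter_upwards [hz, hcon] with x hx hx'
      obtain ⟨l, hl⟩ := hx hx'
      exact Finset.prod_eq_zero (Finset.mem_univ l) hl)
  refine hw.transverse.ne_zero l ?_
  have : w l =ᶠ[𝓝 0] fun _ => 0 := hl
  rw [this.fderiv_eq]
  simp

theorem IsInjectiveAction.det_ne_zero {A : Matrix (Fin q) (Fin q) ℕ} (hA : IsInjectiveAction A) :
    (A.map (fun n : ℕ => (n : ℂ))).det ≠ 0 := by
  have h1 : (A.map (fun n : ℕ => (n : ℤ))).det ≠ 0 := by
    intro h0
    obtain ⟨v, hv, hv0⟩ := Matrix.exists_mulVec_eq_zero_iff.mpr h0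
    exact hv (hA (by simp [hv0]))
  have h2 : (A.map (fun n : ℕ => (n : ℂ))).det =
      (((A.map (fun n : ℕ => (n : ℤ))).det : ℤ) : ℂ) := by
    rw [← eq_intCast (Int.castRingHom ℂ), RingHom.map_det]
    congr 1
  rw [h2]
  exact_mod_cast h1

theorem exists_transpose_equiv {A : Matrix (Fin q) (Fin q) ℕ} (hA : IsInjectiveAction A) :
    ∃ M : (Fin q → ℂ) ≃L[ℂ] (Fin q → ℂ), ∀ v k, M v k = ∑ l, (A l k : ℂ) * v l := by
  set B := (A.map (fun n : ℕ => (n : ℂ))).transpose with hB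
  have hinj : Function.Injective B.mulVecLin := by
    have : IsUnit B := by
      rw [Matrix.isUnit_iff_isUnit_det, hB, Matrix.det_transpose]
      exact hA.det_ne_zero.isUnit
    exact Matrix.mulVec_injective_iff_isUnit.mpr this
  refine ⟨(LinearEquiv.ofInjectiveEndo B.mulVecLin hinj).toContinuousLinearEquiv, fun v k => ?_⟩
  change (B.mulVecLin v) k = _
  rw [Matrix.mulVecLin_apply, Matrix.mulVec, dotProduct]
  rfl

theorem AnalyticAt.exists_log {u : (Fin d → ℂ) → ℂ} (hu : AnalyticAt ℂ u 0) (hu0 : u 0 ≠ 0) :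
    ∃ β : (Fin d → ℂ) → ℂ, AnalyticAt ℂ β 0 ∧
      ∀ᶠ x in 𝓝 (0 : Fin d → ℂ), u x = Complex.exp (β x) := by
  refine ⟨fun x => Complex.log (u 0) + Complex.log (u x / u 0), ?_, ?_⟩
  · refine analyticAt_const.add ((hu.div analyticAt_const hu0).clog ?_)
    simp [div_self hu0]
  · filter_upwards [hu.continuousAt.eventually_ne hu0] with x hx
    rw [Complex.exp_add, Complex.exp_log hu0, Complex.exp_log (div_ne_zero hx hu0),
      mul_div_cancel₀ _ hu0]

/-- With `u k = exp (β k)`, the functions `v k = w k * exp (g k)` satisfy the relation with unit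
`exp (β k + g k ∘ f - (M g) k)`, where `M` is the transposed internal action. The cohomological
equation makes this exponent constant on fibres. -/
theorem IsContractedFibration.exists_monomial_coordinates {ρ C : ℝ}
    (hF : IsContractedFibration f φ s) (hfc : IsUniformlyContracting f ρ C)
    (hf : IsHolomorphicGerm f) (hw : IsSNCAtZero (genCriticalSet f) w)
    (hinj : IsInjectiveAction (internalAction f w)) :
    ∃ v m : Fin q → (Fin d → ℂ) → ℂ, (∀ k, AnalyticAt ℂ (v k) 0) ∧
      (∀ k, ∃ a : ℂ, a ≠ 0 ∧ HasFDerivAt (v k) (a • fderiv ℂ (w k) 0) 0) ∧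
      (∀ k, ContinuousAt (m k) 0 ∧ m k 0 ≠ 0 ∧ m k ∈ leafwiseConstant φ s) ∧
      ∀ k, ∀ᶠ x in 𝓝 (0 : Fin d → ℂ),
        v k (f x) = m k x * ∏ l, v l x ^ internalAction f w l k := by
  choose u hu hu0 hfac using hw.exists_pullback_eq hf
  choose β hβ huβ using fun k => (hu k).exists_log (hu0 k)
  obtain ⟨M, hM⟩ := exists_transpose_equiv hinj
  have hβa : AnalyticAt ℂ (fun x k => β k x) 0 := AnalyticAt.pi hβ
  obtain ⟨g, hg, hgc⟩ := hF.exists_cohomological hfc hf.analyticAt hf.map_zero M hβa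
  have hgk : ∀ k, AnalyticAt ℂ (fun x => g x k) 0 := fun k => (analyticAt_pi_iff.mp hg) k
  refine ⟨fun k x => w k x * Complex.exp (g x k),
    fun k x => Complex.exp (β k x + g (f x) k - M (g x) k), fun k => ?_, fun k => ?_, fun k => ?_,
    fun k => ?_⟩
  · exact (hw.analyticAt k).mul (hgk k).cexp
  · refine ⟨Complex.exp (g 0 k), Complex.exp_ne_zero _, ?_⟩
    have h1 := (hw.analyticAt k).differentiableAt.hasFDerivAt.mul
      (hgk k).cexp.differentiableAt.hasFDerivAt
    rw [hw.map_zero] at h1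
    convert! h1 using 1
    ext1 x
    simp
  · refine ⟨?_, Complex.exp_ne_zero _, ?_⟩
    · have h1 := (hβ k).continuousAt
      have h2 : ContinuousAt (fun x => g (f x) k) 0 := (hf.analyticAt_comp (hgk k)).continuousAt
      have h3 : ContinuousAt (fun x => M (g x) k) 0 :=
        (continuous_apply k).continuousAt.comp (M.continuous.continuousAt.comp hg.continuousAt)
      exact ((h1.add h2).sub h3).cexp
    · change ∀ᶠ z : (Fin d → ℂ) × (Fin d → ℂ) in 𝓝 0, _
      filter_upwards [hgc] with z hz hs
      have := congrFun (hz hs) k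
      simp only [Pi.add_apply, Pi.sub_apply] at this
      rw [this]
  · filter_upwards [hfac k, huβ k] with x hx hx'
    simp only [mul_pow, Finset.prod_mul_distrib, ← Complex.exp_nat_mul]
    rw [hx, hx', ← Complex.exp_sum, hM, Complex.exp_sub, Complex.exp_add]
    field_simp

end Monomial

/-! ### Non-periodic components -/

section Nonperiodic

variable {d q s : ℕ} {f : (Fin d → ℂ) → (Fin d → ℂ)} {w : Fin q → (Fin d → ℂ) → ℂ}

theorem Matrix.mulVec_single_one_eq {A : Matrix (Fin q) (Fin q) ℕ} {k l : Fin q}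
    (h : ∀ i, A i k = if i = l then 1 else 0) : A.mulVec (Pi.single k 1) = Pi.single l 1 := by
  rw [Matrix.mulVec_single_one]
  funext i
  rw [Matrix.col_apply, h i, Pi.single_apply]

/-- The differential of a component is mapped by `df₀ᵀ` to zero or to a multiple of the differential
of a component. -/
theorem IsSNCAtZero.fderiv_comp_differential (hw : IsSNCAtZero (genCriticalSet f) w)
    (hf : IsHolomorphicGerm f) (k : Fin q) :
    (fderiv ℂ (w k) 0).comp (fderiv ℂ f 0) = 0 ∨
      ∃ (l : Fin q) (a : ℂ), (fderiv ℂ (w k) 0).comp (fderiv ℂ f 0) = a • fderiv ℂ (w l) 0 ∧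
        (internalAction f w).mulVec (Pi.single k 1) = Pi.single l 1 := by
  obtain ⟨u, hu, hu0, hfac⟩ := hw.exists_pullback_eq hf k
  set A := internalAction f w with hA
  have hd : fderiv ℂ (fun x => u x * ∏ l, w l x ^ A l k) 0 =
      (fderiv ℂ (w k) 0).comp (fderiv ℂ f 0) := by
    have h1 : HasFDerivAt (w k) (fderiv ℂ (w k) 0) (f 0) := by
      rw [hf.map_zero]
      exact (hw.analyticAt k).differentiableAt.hasFDerivAt
    rw [← (h1.comp 0 hf.analyticAt.differentiableAt.hasFDerivAt).fderiv]
    exact (Filter.EventuallyEq.fderiv_eq hfac).symm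
  rw [← hd]
  have hpr : ∀ l m, w l ^ m ∈ vanishingSubmodule d m := fun l m => by
    have := prod_mem_vanishingSubmodule (Finset.univ : Finset (Fin m)) (a := fun _ => w l)
      fun _ _ => mem_vanishingSubmodule_one (hw.analyticAt l) (hw.map_zero l)
    simpa using this
  -- If the `k`-th column of `A` has sum at least two, the product vanishes to order two and its
  -- differential is zero. Sum zero is impossible because `w k (f 0) = 0`, and sum one gives a
  -- single `w l` times a unit.
  by_cases hbig : ∃ l, 2 ≤ A l k
  · obtain ⟨l, hl⟩ := hbig
    left
    have h1 := vanishingSubmodule_anti hl (hpr l (A l k))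
    have h2 : u * ∏ i ∈ Finset.univ.erase l, w i ^ A i k ∈ vanishingSubmodule d 0 := by
      have hana : AnalyticAt ℂ (u * ∏ i ∈ Finset.univ.erase l, w i ^ A i k) 0 :=
        hu.mul (Finset.analyticAt_prod _ fun i _ => (hw.analyticAt i).pow _)
      refine ⟨hana, ?_⟩
      simpa using hana.continuousAt.isBigO_one (F := ℝ)
    have h3 := mul_mem_vanishingSubmodule h2 h1
    rw [← (fderiv_eq_zero_of_mem_vanishingSubmodule h3).2.fderiv]
    congr 1
    funext x
    simp only [Pi.mul_apply, Finset.prod_apply, Pi.pow_apply]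
    rw [← Finset.mul_prod_erase _ _ (Finset.mem_univ l)]
    ring
  push Not at hbig
  by_cases hex : ∃ l, A l k = 1
  swap
  · push Not at hex
    have hzero : ∀ l, A l k = 0 := fun l => by
      have := hbig l
      have := hex l
      omega
    have := hfac.self_of_nhds
    simp [hzero, hf.map_zero, hw.map_zero] at this
    exact absurd this.symm hu0
  obtain ⟨l, hl⟩ := hex
  by_cases hother : ∃ l', l' ≠ l ∧ A l' k ≠ 0
  · obtain ⟨l', hl', hne⟩ := hother
    left
    have h1 := mul_mem_vanishingSubmodule (vanishingSubmodule_anti (Nat.one_le_iff_ne_zero.mpr hne)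
      (hpr l' (A l' k))) (vanishingSubmodule_anti hl.ge (hpr l (A l k)))
    have h2 : u * ∏ i ∈ (Finset.univ.erase l).erase l', w i ^ A i k ∈ vanishingSubmodule d 0 := by
      have hana : AnalyticAt ℂ (u * ∏ i ∈ (Finset.univ.erase l).erase l', w i ^ A i k) 0 :=
        hu.mul (Finset.analyticAt_prod _ fun i _ => (hw.analyticAt i).pow _)
      refine ⟨hana, ?_⟩
      simpa using hana.continuousAt.isBigO_one (F := ℝ)
    have h3 := mul_mem_vanishingSubmodule h2 h1
    rw [← (fderiv_eq_zero_of_mem_vanishingSubmodule h3).2.fderiv]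
    congr 1
    funext x
    simp only [Pi.mul_apply, Finset.prod_apply, Pi.pow_apply]
    rw [← Finset.mul_prod_erase _ _ (Finset.mem_univ l),
      ← Finset.mul_prod_erase _ _ (Finset.mem_erase.mpr ⟨hl', Finset.mem_univ l'⟩)]
    ring
  · push Not at hother
    have hcol : ∀ i, A i k = if i = l then 1 else 0 := fun i => by
      split_ifs with h
      · rw [h, hl]
      · exact hother i h
    refine Or.inr ⟨l, u 0, ?_, Matrix.mulVec_single_one_eq hcol⟩
    have h1 : (fun x => u x * ∏ i, w i x ^ A i k) = u * w l := by
      funext x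
      simp only [hcol, Pi.mul_apply]
      congr 1
      rw [Finset.prod_eq_single l (fun i _ hi => by simp [hi]) (by simp)]
      simp
    rw [h1, (hu.differentiableAt.hasFDerivAt.mul
      (hw.analyticAt l).differentiableAt.hasFDerivAt).fderiv, hw.map_zero]
    ext1 x
    simp

/-- The linear forms killed by some power of `T` acting on the right. -/
def eventuallyKilled (T : (Fin d → ℂ) →L[ℂ] (Fin d → ℂ)) :
    Submodule ℂ ((Fin d → ℂ) →L[ℂ] ℂ) where
  carrier := {η | ∃ n, η.comp (T ^ n) = 0}
  zero_mem' := ⟨0, by simp⟩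
  add_mem' := by
    rintro η₁ η₂ ⟨n, hn⟩ ⟨m, hm⟩
    refine ⟨n + m, ?_⟩
    rw [ContinuousLinearMap.add_comp]
    conv_lhs => rw [pow_add]; arg 2; rw [← pow_add, add_comm, pow_add]
    change (η₁.comp (T ^ n)).comp (T ^ m) + (η₂.comp (T ^ m)).comp (T ^ n) = 0
    rw [hn, hm]
    simp
  smul_mem' := by
    rintro c η ⟨n, hn⟩
    exact ⟨n, by rw [ContinuousLinearMap.smul_comp, hn]; ext1 x; simp⟩

/-- The components whose differentials are never killed are sent to one another by the internal
action. This self-map of a finite set is injective because the action is, so it is a permutation and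
each such component is periodic. -/
theorem IsSNCAtZero.fderiv_mem_eventuallyKilled (hw : IsSNCAtZero (genCriticalSet f) w)
    (hf : IsHolomorphicGerm f) (hinj : IsInjectiveAction (internalAction f w)) {k : Fin q}
    (hk : ¬ IsPeriodicComponent (internalAction f w) k) :
    fderiv ℂ (w k) 0 ∈ eventuallyKilled (fderiv ℂ f 0) := by
  set A := internalAction f w with hA
  by_contra hcon
  set S := {k : Fin q // fderiv ℂ (w k) 0 ∉ eventuallyKilled (fderiv ℂ f 0)}
  have key : ∀ k : S, ∃ l : S, A.mulVec (Pi.single (k : Fin q) 1) = Pi.single (l : Fin q) 1 := by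
    rintro ⟨k, hk⟩
    rcases hw.fderiv_comp_differential hf k with h | ⟨l, a, h, hl⟩
    · exact absurd ⟨1, by rw [pow_one]; exact h⟩ hk
    · refine ⟨⟨l, fun ⟨n, hn⟩ => hk ⟨n + 1, ?_⟩⟩, hl⟩
      rw [pow_succ']
      change ((fderiv ℂ (w k) 0).comp (fderiv ℂ f 0)).comp (fderiv ℂ f 0 ^ n) = 0
      rw [h, ContinuousLinearMap.smul_comp, hn]
      ext1 x
      simp
  choose κ hκ using key
  have hinjN : Function.Injective (fun v : Fin q → ℕ => A.mulVec v) := by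
    intro v v' hv
    have h1 := hinj (a₁ := fun i => (v i : ℤ)) (a₂ := fun i => (v' i : ℤ)) (by
      funext i
      have h2 := congrFun hv i
      simp only [Matrix.mulVec, dotProduct, Matrix.map_apply] at h2 ⊢
      exact_mod_cast h2)
    funext i
    exact_mod_cast congrFun h1 i
  have hκi : Function.Injective κ := by
    intro k k' hkk
    have h1 : A.mulVec (Pi.single (k : Fin q) 1) = A.mulVec (Pi.single (k' : Fin q) 1) := by
      rw [hκ, hκ, hkk]
    have h2 := congrFun (hinjN h1) k
    rw [Pi.single_eq_same, Pi.single_apply] at h2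
    by_contra hne
    rw [if_neg (fun h => hne (Subtype.ext h))] at h2
    exact one_ne_zero h2
  have hpow : ∀ n (k : S), (A ^ n).mulVec (Pi.single (k : Fin q) 1)
      = Pi.single ((κ^[n] k : S) : Fin q) 1 := by
    intro n
    induction n with
    | zero =>
      intro k
      rw [pow_zero, Matrix.one_mulVec, Function.iterate_zero_apply]
    | succ n ih =>
      intro k
      rw [pow_succ, ← Matrix.mulVec_mulVec, hκ, ih, Function.iterate_succ_apply]
  obtain ⟨n, hn, hper⟩ := hκi.mem_periodicPts ⟨k, hcon⟩
  refine hk ⟨n, hn, ?_⟩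
  have h1 := hpow n ⟨k, hcon⟩
  rw [hper] at h1
  exact h1

/-- Descending induction on `i`: once `η` vanishes on the later basis vectors, triangularity gives
`η (Tⁿ (b i)) = μ i ^ n * η (b i)`, where `μ i ≠ 0` for `i < s`. -/
theorem IsAdaptedBasis.eq_zero_of_mem_eventuallyKilled
    {b : Module.Basis (Fin d) ℂ (Fin d → ℂ)} {μ : Fin d → ℂ}
    (hb : IsAdaptedBasis (differentialAtZero f) b μ s) {η : (Fin d → ℂ) →L[ℂ] ℂ}
    (hη : η ∈ eventuallyKilled (fderiv ℂ f 0)) (hs : ∀ i : Fin d, s ≤ i → η (b i) = 0) : η = 0 := by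
  obtain ⟨n, hn⟩ := hη
  have hT : ∀ x, differentialAtZero f x = fderiv ℂ f 0 x := fun x => rfl
  have hall : ∀ i, η (b i) = 0 := by
    intro i
    induction i using WellFoundedGT.induction with
    | ind i ih =>
    by_cases hi : (i : ℕ) < s
    swap
    · exact hs i (by omega)
    have hspan : ∀ θ : (Fin d → ℂ) →L[ℂ] ℂ, (∀ j, i < j → θ (b j) = 0) → ∀ j, i ≤ j →
        θ (fderiv ℂ f 0 (b j)) = μ j * θ (b j) := by
      intro θ hθ j hj
      have h1 : Submodule.span ℂ (b '' Set.Ioi j) ≤ LinearMap.ker (θ : (Fin d → ℂ) →ₗ[ℂ] ℂ) := by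
        rw [Submodule.span_le]
        rintro _ ⟨l, hl, rfl⟩
        exact hθ l (hj.trans_lt hl)
      have h2 : θ (differentialAtZero f (b j) - μ j • b j) = 0 := h1 (hb.mem_span j)
      rw [map_sub, map_smul, smul_eq_mul, sub_eq_zero, hT] at h2
      exact h2
    have hn' : ∀ n, (∀ j, i < j → (η.comp (fderiv ℂ f 0 ^ n)) (b j) = 0) ∧
        (η.comp (fderiv ℂ f 0 ^ n)) (b i) = μ i ^ n * η (b i) := by
      intro n
      induction n with
      | zero => exact ⟨fun j hj => by simpa using ih j hj, by simp⟩
      | succ n ihn =>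
        have hcomp : ∀ x, (η.comp (fderiv ℂ f 0 ^ (n + 1))) x =
            (η.comp (fderiv ℂ f 0 ^ n)) (fderiv ℂ f 0 x) := by
          intro x
          rw [pow_succ]
          rfl
        refine ⟨fun j hj => ?_, ?_⟩
        · rw [hcomp, hspan _ ihn.1 j hj.le, ihn.1 j hj, mul_zero]
        · rw [hcomp, hspan _ ihn.1 i le_rfl, ihn.2, pow_succ]
          ring
    have h3 := (hn' n).2
    rw [hn] at h3
    exact (mul_eq_zero.mp h3.symm).resolve_left (pow_ne_zero _ ((hb.ne_zero_iff i).mpr hi))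
  have : (η : (Fin d → ℂ) →ₗ[ℂ] ℂ) = 0 := b.ext fun i => by simpa using hall i
  exact ContinuousLinearMap.coe_injective this

end Nonperiodic

/-! ### The foliations -/

section Foliations

variable {d q s : ℕ} {f : (Fin d → ℂ) → (Fin d → ℂ)} {w : Fin q → (Fin d → ℂ) → ℂ}

theorem surjective_fderiv_of_linearIndependent {n : ℕ} {θ : Fin n → (Fin d → ℂ) → ℂ}
    (hθ : ∀ i, AnalyticAt ℂ (θ i) 0) (hli : LinearIndependent ℂ fun i => fderiv ℂ (θ i) 0) :
    Function.Surjective (fderiv ℂ (fun x i => θ i x) 0) := by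
  obtain ⟨v, hv⟩ := hli.exists_dual_vectors
  intro y
  refine ⟨∑ m, y m • v m, ?_⟩
  rw [(hasFDerivAt_pi.mpr fun i => (hθ i).differentiableAt.hasFDerivAt).fderiv]
  funext i
  simp [hv]

/-- The foliation defined by holomorphic germs with independent differentials. -/
def SmoothFoliationGerm.ofFunctions {n : ℕ} (θ : Fin n → (Fin d → ℂ) → ℂ)
    (hθ : ∀ i, AnalyticAt ℂ (θ i) 0) (hli : LinearIndependent ℂ fun i => fderiv ℂ (θ i) 0) :
    SmoothFoliationGerm d n where
  proj := fun x i => θ i x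
  analyticAt := AnalyticAt.pi hθ
  submersion := surjective_fderiv_of_linearIndependent hθ hli

theorem numNonzeroEigenvalues_le (f : (Fin d → ℂ) → (Fin d → ℂ)) : numNonzeroEigenvalues f ≤ d := by
  refine (Multiset.card_le_card (Multiset.filter_le _ _)).trans ((Polynomial.card_roots' _).trans ?_)
  rw [LinearMap.charpoly_natDegree]
  simp

theorem IsHolomorphicGerm.exists_isUniformlyContracting (hf : IsHolomorphicGerm f)
    {b : Module.Basis (Fin d) ℂ (Fin d → ℂ)} {μ : Fin d → ℂ}
    (hb : IsAdaptedBasis (differentialAtZero f) b μ s) (hμ : ∀ i, ‖μ i‖ < 1) :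
    ∃ ρ C, IsUniformlyContracting f ρ C := by
  obtain ⟨e, ρ₀, h0, h1, he⟩ := hb.exists_contracting_equiv hμ
  obtain ⟨ρ, C, hρ, hρ1, hC, hn⟩ := exists_invariant_nhds hf.analyticAt.differentiableAt
    hf.map_zero e h0 h1 he
  exact ⟨ρ, C, hρ, hρ1, hC, hn⟩

end Foliations

theorem mainTheorem6 {d q : ℕ} (f : (Fin d → ℂ) → (Fin d → ℂ))
    (hf : IsHolomorphicGerm f) (hcontr : IsContractingGerm f)
    (w : Fin q → (Fin d → ℂ) → ℂ) (hrigid : IsSNCAtZero (genCriticalSet f) w)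
    (hinj : IsInjectiveAction (internalAction f w))
    (hfixed : ∀ k, IsPeriodicComponent (internalAction f w) k →
      IsFixedComponent (internalAction f w) k)
    (hnil : NilpotentPartVanishes f) :
    ∃ (F : ∀ k : Set.Icc 1 (numNonzeroEigenvalues f), SmoothFoliationGerm d (k : ℕ))
      (G : SmoothFoliationGerm d
        (numNonzeroEigenvalues f + numNonperiodic (internalAction f w))),
      (∀ k, (F k).IsPreservedBy f) ∧ G.IsPreservedBy f ∧
      (∀ k l, k ≤ l → (F l).IsSubfoliation (F k)) ∧
      (∀ k : Set.Icc 1 (numNonzeroEigenvalues f), (k : ℕ) = numNonzeroEigenvalues f → G.IsSubfoliation (F k)) := by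
  obtain ⟨b, μ, hb'⟩ := exists_isAdaptedBasis (differentialAtZero f)
  have hb : IsAdaptedBasis (differentialAtZero f) b μ (numNonzeroEigenvalues f) := hb'
  have hsd := numNonzeroEigenvalues_le f
  set s := numNonzeroEigenvalues f with hs
  have hμ : ∀ i, ‖μ i‖ < 1 := fun i => hcontr _ (hb.hasEigenvalue i)
  obtain ⟨ρ, C, hfc⟩ := hf.exists_isUniformlyContracting hb hμ
  obtain ⟨φ, hφ⟩ := hb.exists_triangular hf hμ hfc
  have hpres : ∀ k ≤ s, ∀ᶠ z : (Fin d → ℂ) × (Fin d → ℂ) in 𝓝 0,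
      SameFibre φ k z.1 z.2 → SameFibre φ k (f z.1) (f z.2) := fun k hk =>
    eventually_comp_of_mem_leafwiseConstant fun i hi => (hφ i (hi.trans_le hk)).2
  have hF : IsContractedFibration f φ s :=
    ⟨hpres s le_rfl, fun ε hε => hb.eventually_norm_sub_le hf hnil (fun i hi => (hφ i hi).1) hε,
      exists_retraction fun i hi => (hφ i hi).1⟩
  obtain ⟨v, m, hv, hvd, hm, hvf⟩ := hF.exists_monomial_coordinates hfc hf hrigid hinj
  set A := internalAction f w with hA
  have hφd : ∀ i : Fin d, (i : ℕ) < s → AnalyticAt ℂ (φ i) 0 ∧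
      fderiv ℂ (φ i) 0 = LinearMap.toContinuousLinearMap (b.coord i) := fun i hi =>
    ⟨(hasFDerivAt_of_sub_coord_mem (hφ i hi).1).1,
      (hasFDerivAt_of_sub_coord_mem (hφ i hi).1).2.2.fderiv⟩
  have hcoord : LinearIndependent ℂ fun i => LinearMap.toContinuousLinearMap (b.coord i) := by
    have h1 := b.dualBasis.linearIndependent
    have h2 := h1.map' (LinearMap.toContinuousLinearMap : ((Fin d → ℂ) →ₗ[ℂ] ℂ) ≃ₗ[ℂ] _).toLinearMap
      (LinearEquiv.ker _)
    simpa [Function.comp_def] using h2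
  have hFli : ∀ k (hk : k ≤ s), LinearIndependent ℂ
      fun i : Fin k => fderiv ℂ (φ (Fin.castLE (hk.trans hsd) i)) 0 := by
    intro k hk
    have h1 := hcoord.comp (Fin.castLE (hk.trans hsd)) (Fin.castLE_injective _)
    convert! h1 using 2 with i
    exact (hφd _ (i.2.trans_le hk)).2
  let F : ∀ k : Set.Icc 1 s, SmoothFoliationGerm d (k : ℕ) := fun k =>
    SmoothFoliationGerm.ofFunctions (fun i : Fin k => φ (Fin.castLE (k.2.2.trans hsd) i))
      (fun i => (hφd _ (i.2.trans_le k.2.2)).1) (hFli k k.2.2)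
  have hFsame : ∀ k x y, (F k).SameLeaf x y ↔ SameFibre φ k x y := by
    intro k x y
    refine ⟨fun h i hi => ?_, fun h => funext fun i => h _ i.2⟩
    exact congrFun h ⟨i, hi⟩
  let e : {k : Fin q // ¬ IsPeriodicComponent A k} ≃ Fin (numNonperiodic A) := Finite.equivFin _
  let θ : Fin (s + numNonperiodic A) → (Fin d → ℂ) → ℂ := fun j =>
    Sum.elim (fun i : Fin s => φ (Fin.castLE hsd i)) (fun i => v (e.symm i)) (finSumFinEquiv.symm j)
  have hθ : ∀ j, AnalyticAt ℂ (θ j) 0 := by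
    intro j
    change AnalyticAt ℂ (Sum.elim _ _ (finSumFinEquiv.symm j)) 0
    rcases finSumFinEquiv.symm j with i | i
    · exact (hφd _ i.2).1
    · exact hv _
  have hθli : LinearIndependent ℂ fun j => fderiv ℂ (θ j) 0 := by
    have hsum : LinearIndependent ℂ (Sum.elim
        (fun i : Fin s => fderiv ℂ (φ (Fin.castLE hsd i)) 0)
        (fun i => fderiv ℂ (v (e.symm i)) 0)) := by
      refine (hFli s le_rfl).sum_type ?_ ?_
      · choose a ha hva using hvd
        have h1 := (hrigid.transverse.comp (fun i => ((e.symm i : {k : Fin q // _}) : Fin q))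
          (Subtype.val_injective.comp e.symm.injective)).units_smul
            fun i => Units.mk0 (a (e.symm i)) (ha _)
        convert! h1 using 2 with i
        exact (hva _).fderiv
      -- A common element is killed by a power of `df₀`, coming from the non-periodic side, and
      -- vanishes on `b i` for `i ≥ s`, coming from the coordinate side.
      · rw [Submodule.disjoint_def]
        intro η h1 h2
        refine hb.eq_zero_of_mem_eventuallyKilled ?_ fun i hi => ?_
        · refine Submodule.span_le.mpr ?_ h2
          rintro _ ⟨i, rfl⟩
          obtain ⟨a, -, ha⟩ := hvd (e.symm i)
          simp only [ha.fderiv]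
          exact Submodule.smul_mem _ _
            (hrigid.fderiv_mem_eventuallyKilled hf hinj (e.symm i).2)
        · have h3 : Submodule.span ℂ (Set.range fun i : Fin s =>
              fderiv ℂ (φ (Fin.castLE hsd i)) 0) ≤
              LinearMap.ker (ContinuousLinearMap.apply ℂ ℂ (b i)).toLinearMap := by
            rw [Submodule.span_le]
            rintro _ ⟨j, rfl⟩
            simp only [(hφd _ (show ((Fin.castLE hsd j : Fin d) : ℕ) < s from j.2)).2]
            change b.coord _ (b i) = 0
            rw [b.coord_apply, b.repr_self, Finsupp.single_apply, if_neg]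
            intro h
            rw [h] at hi
            exact absurd j.2 (not_lt.mpr hi)
          exact h3 h1
    have h2 := hsum.comp finSumFinEquiv.symm finSumFinEquiv.symm.injective
    convert! h2 using 2 with j
    change fderiv ℂ (Sum.elim _ _ (finSumFinEquiv.symm j)) 0 = _
    simp only [Function.comp_apply]
    rcases finSumFinEquiv.symm j with i | i <;> rfl
  let G := SmoothFoliationGerm.ofFunctions θ hθ hθli
  have hGsame : ∀ x y, G.SameLeaf x y ↔ SameFibre φ s x y ∧
      ∀ k, ¬ IsPeriodicComponent A k → v k x = v k y := by
    intro x y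
    constructor
    · intro h
      refine ⟨fun i hi => ?_, fun k hk => ?_⟩
      · have := congrFun h (finSumFinEquiv (Sum.inl ⟨i, hi⟩))
        change θ _ x = θ _ y at this
        simp only [θ, Equiv.symm_apply_apply] at this
        exact this
      · have := congrFun h (finSumFinEquiv (Sum.inr (e ⟨k, hk⟩)))
        change θ _ x = θ _ y at this
        simp only [θ, Equiv.symm_apply_apply, Sum.elim_inr] at this
        exact this
    · rintro ⟨h1, h2⟩
      funext j
      change θ j x = θ j y
      simp only [θ]
      rcases finSumFinEquiv.symm j with i | i
      · exact h1 _ i.2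
      · exact h2 _ (e.symm i).2
  have hvper : ∀ k, IsPeriodicComponent A k → v k ∈ leafwiseConstant φ s := by
    intro k hk
    refine hF.mem_leafwiseConstant hfc (hv k) (hm k).1 (hm k).2.1 (hm k).2.2 ?_
    -- Being fixed, and not merely periodic, reduces the monomial relation to `v k ∘ f = m k * v k`.
    have hcol : ∀ i, A i k = if i = k then 1 else 0 := fun i => by
      have := congrFun (hfixed k hk) i
      rwa [Matrix.mulVec_single_one, Matrix.col_apply, Pi.single_apply] at this
    filter_upwards [hvf k] with x hx
    rw [hx]
    congr 1
    simp only [hcol]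
    rw [Finset.prod_eq_single k (fun i _ hi => by simp [hi]) (by simp)]
    simp
  refine ⟨F, G, fun k => ?_, ?_, fun k l hkl => ?_, fun k hk => ?_⟩
  · obtain ⟨U, hU, h⟩ := exists_nhds_of_eventually (hpres k k.2.2)
    exact ⟨U, hU, fun x hx y hy hxy =>
      (hFsame k _ _).mpr (h x hx y hy ((hFsame k _ _).mp hxy))⟩
  · have hvall : ∀ k, ∀ᶠ z : (Fin d → ℂ) × (Fin d → ℂ) in 𝓝 0,
        SameFibre φ s z.1 z.2 → IsPeriodicComponent A k → v k z.1 = v k z.2 := by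
      intro k
      by_cases hk : IsPeriodicComponent A k
      · have h1 := hvper k hk
        filter_upwards [h1] with z hz hs _ using hz hs
      · exact Filter.Eventually.of_forall fun z _ h => absurd h hk
    have hmall : ∀ k, ∀ᶠ z : (Fin d → ℂ) × (Fin d → ℂ) in 𝓝 0,
        SameFibre φ s z.1 z.2 → m k z.1 = m k z.2 := fun k => (hm k).2.2
    obtain ⟨U, hU, h⟩ := exists_nhds_of_eventually ((hpres s le_rfl).and
      ((Filter.eventually_all.mpr hvall).and ((Filter.eventually_all.mpr hmall).and
        (eventually_fst_snd (Filter.eventually_all.mpr hvf)))))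
    refine ⟨U, hU, fun x hx y hy hxy => ?_⟩
    obtain ⟨h1, h2⟩ := (hGsame x y).mp hxy
    obtain ⟨hp, hvp, hmp, hfx, hfy⟩ := h x hx y hy
    -- The monomial formula for `v k (f x)` may involve periodic components as well; these agree at
    -- `x` and `y` although they do not define the leaf.
    have hveq : ∀ k, v k x = v k y := fun k => by
      by_cases hk : IsPeriodicComponent A k
      · exact hvp k h1 hk
      · exact h2 k hk
    refine (hGsame _ _).mpr ⟨hp h1, fun k _ => ?_⟩
    rw [hfx k, hfy k, hmp k h1]
    simp only [hveq]
  · refine ⟨Set.univ, Filter.univ_mem, fun x _ y _ hxy => (hFsame k _ _).mpr ?_⟩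
    exact fun i hi => (hFsame l _ _).mp hxy i (hi.trans_le hkl)
  · refine ⟨Set.univ, Filter.univ_mem, fun x _ y _ hxy => (hFsame k _ _).mpr ?_⟩
    rw [hk]
    exact ((hGsame x y).mp hxy).1
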